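/- Let $p,q\in L_2(0,\pi)$ be real valued, $h_1,h_2\in\mathbb R$, $h_2>0$, and put $l(y)=\begin{pmatrix} y_2'+p y_1+q y_2\\ -y_1'+q y_1-p y_2\end{pmatrix}$ for $y=(y_1,y_2)^T$. Consider the boundary value problem $$l(y)=\lambda y\ \ (0<x<\pi),\qquad y_1(0)=0,\qquad (\lambda+h_1)y_1(\pi)+h_2y_2(\pi)=0,$$ where solutions have components in $AC[0,\pi]$ and satisfy the system almost everywhere. A number $\lambda\in\mathbb C$ is an eigenvalue if the problem has a solution that is not identically zero. On $H=L_2(0,\pi;\mathbb C^2)\oplus\mathbb C$ use the inner product $\langle Y,Z\rangle_H=\int_0^\pi (y_1\overline{z_1}+y_2\overline{z_2})\,dx+\frac1{h_2}y_3\overline{z_3}$, write $\langle f,g\rangle=\int_0^\pi (f_1\overline{g_1}+f_2\overline{g_2})\,dx$ and $\|f\|^2=\langle f,f\rangle$ on $L_2(0,\pi;\mathbb C^2)$, and let $$D(L)=\{(y_1,y_2,y_3): y_1,y_2\in AC[0,\pi],\ y_3=y_1(\pi),\ l(y)\in L_2(0,\pi;\mathbb C^2),\ y_1(0)=0\}$$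 (the domain in $H$ of the operator $L(Y)=(l(y),\,-h_1y_1(\pi)-h_2y_2(\pi))$, whose eigenvalue equation $LY=\lambda Y$ is the boundary value problem). For every $\lambda\in\mathbb C$ there is a solution $\varphi(\cdot,\lambda)$ of $l(y)=\lambda y$ with $\varphi(0,\lambda)=(0,-1)^T$ (it is unique on $[0,\pi]$), and the set of eigenvalues is countably infinite. Let $(\lambda_n)_{n\in\mathbb Z}$ be any enumeration of all eigenvalues, each listed once, and put $$\alpha_n=\int_0^\pi\left(|\varphi_1(x,\lambda_n)|^2+|\varphi_2(x,\lambda_n)|^2\right)dx+\frac1{h_2}|\varphi_1(\pi,\lambda_n)|^2 .$$ Then: a) The system $\varphi(\cdot,\lambda_n)$, $n\in\mathbb Z$, is complete in $L_2(0,\pi;\mathbb C^2)$, i.e. its finite linear combinations are dense. b) For every $Y=(f,f_1(\pi))\in D(L)$, with $a_n=\frac1{\alpha_n}\langle Y,\Phi_n\rangle_H$ and $\Phi_n=(\varphi(\cdot,\lambda_n),\varphi_1(\pi,\lambda_n))$, the expansion $$f(x)=\sum_{n=-\infty}^{\infty}a_n\varphi(x,\lambda_n)$$ holds, and the series converges (unconditionally)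 uniformly in $x\in[0,\pi]$. For every $f\in L_2(0,\pi;\mathbb C^2)$, with $a_n=\frac1{\alpha_n}\langle f,\varphi(\cdot,\lambda_n)\rangle$, the series $\sum_n a_n\varphi(\cdot,\lambda_n)$ converges (unconditionally) to $f$ in $L_2(0,\pi;\mathbb C^2)$, and $$\|f\|^2=\sum_{n=-\infty}^{\infty}\alpha_n|a_n|^2 .$$ -/

import Mathlib

open MeasureTheory Set Filter Topology
open scoped Real ComplexConjugate ENNReal

noncomputable section

namespace DiracBVP

/-- `ℂ²` with its Hermitian norm; the components `y₁, y₂` of a vector `y` are `y 0, y 1`. -/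
abbrev C2 : Type := EuclideanSpace ℂ (Fin 2)

/-- Lebesgue measure on the interval `(0, π)`. -/
abbrev mu : Measure ℝ := volume.restrict (Ioo 0 π)

/-- Both components of `y` are absolutely continuous on `[0, π]`. -/
def IsAC (y : ℝ → C2) : Prop :=
  ∀ i : Fin 2, AbsolutelyContinuousOnInterval (fun x => y x i) 0 π

/-- The Dirac differential expression `l(y) = B y' + Ω(x) y`, where
`B = (0 1; -1 0)` and `Ω = (p q; q -p)`. -/
def diracExpr (p q : ℝ → ℝ) (y : ℝ → C2) (x : ℝ) : C2 :=
  !₂[deriv (fun t => y t 1) x + (p x : ℂ) * y x 0 + (q x : ℂ) * y x 1,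
     -deriv (fun t => y t 0) x + (q x : ℂ) * y x 0 - (p x : ℂ) * y x 1]

/-- `y` is a (Carathéodory) solution on `[0, π]` of `B y' + Ω(x) y = lam y`. -/
def IsSolution (p q : ℝ → ℝ) (lam : ℂ) (y : ℝ → C2) : Prop :=
  IsAC y ∧ ∀ᵐ x ∂mu, diracExpr p q y x = lam • y x

/-- `lam` is an eigenvalue of the problem `B y' + Ω(x) y = lam y`, `y₁(0) = 0`,
`(lam + h₁) y₁(π) + h₂ y₂(π) = 0`: there is a solution that is not identically zero. -/
def IsEigenvalue (p q : ℝ → ℝ) (h₁ h₂ : ℝ) (lam : ℂ) : Prop :=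
  ∃ y : ℝ → C2, IsSolution p q lam y ∧ (∃ x ∈ Icc 0 π, y x ≠ 0) ∧
    y 0 0 = 0 ∧ (lam + h₁) * y π 0 + h₂ * y π 1 = 0

/-- `y` is a solution with the initial value `y(0) = (0, -1)`. -/
def IsPhi (p q : ℝ → ℝ) (lam : ℂ) (y : ℝ → C2) : Prop :=
  IsSolution p q lam y ∧ y 0 = !₂[0, -1]

/-- The solution `φ(·, lam)` of the system with `φ(0, lam) = (0, -1)`; only its values on
`[0, π]`, where it is unique, matter. -/
def phi (p q : ℝ → ℝ) (lam : ℂ) : ℝ → C2 :=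
  Classical.epsilon (IsPhi p q lam)

/-- The inner product `∫₀^π (f₁ conj(g₁) + f₂ conj(g₂)) dx` of `L₂(0, π; ℂ²)`. -/
def l2Inner (f g : ℝ → C2) : ℂ :=
  ∫ x, (f x 0 * conj (g x 0) + f x 1 * conj (g x 1)) ∂mu

/-- The inner product of `H = L₂(0, π; ℂ²) ⊕ ℂ`, weighted by `1 / h₂` on the last summand. -/
def hInner (h₂ : ℝ) (Y Z : (ℝ → C2) × ℂ) : ℂ :=
  l2Inner Y.1 Z.1 + 1 / (h₂ : ℂ) * Y.2 * conj Z.2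

/-- The domain `D(L)`: triples `(y₁, y₂, y₃)` with `y₁, y₂ ∈ AC[0, π]`, `y₃ = y₁(π)`,
`l(y) ∈ L₂(0, π; ℂ²)` and `y₁(0) = 0`. The boundary condition at `π` contains the spectral
parameter; it is not a restriction of the domain but is encoded by the third component of
`L(Y) = (l(y), -h₁ y₁(π) - h₂ y₂(π))`. -/
def domL (p q : ℝ → ℝ) : Set ((ℝ → C2) × ℂ) :=
  {Y | IsAC Y.1 ∧ Y.2 = Y.1 π 0 ∧ MemLp (diracExpr p q Y.1) 2 mu ∧ Y.1 0 0 = 0}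

/-- The element `(φ(·, lam), φ₁(π, lam))` of `H`. -/
def phiH (p q : ℝ → ℝ) (lam : ℂ) : (ℝ → C2) × ℂ :=
  (phi p q lam, phi p q lam π 0)

/-- The normalizing number
`∫₀^π (|φ₁(x, lam)|² + |φ₂(x, lam)|²) dx + |φ₁(π, lam)|² / h₂`. -/
def alpha (p q : ℝ → ℝ) (h₂ : ℝ) (lam : ℂ) : ℝ :=
  (∫ x, (‖phi p q lam x 0‖ ^ 2 + ‖phi p q lam x 1‖ ^ 2) ∂mu)
    + 1 / h₂ * ‖phi p q lam π 0‖ ^ 2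

/-- The expansion coefficient `⟨Y, Φ⟩_H / α` of `Y ∈ H`, with `Φ = (φ(·, lam), φ₁(π, lam))`. -/
def coeffH (p q : ℝ → ℝ) (h₂ : ℝ) (Y : (ℝ → C2) × ℂ) (lam : ℂ) : ℂ :=
  hInner h₂ Y (phiH p q lam) / (alpha p q h₂ lam : ℂ)

/-- The expansion coefficient `⟨f, φ(·, lam)⟩ / α` of `f ∈ L₂(0, π; ℂ²)`. -/
def coeff (p q : ℝ → ℝ) (h₂ : ℝ) (f : ℝ → C2) (lam : ℂ) : ℂ :=
  l2Inner f (phi p q lam) / (alpha p q h₂ lam : ℂ)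

/-- `lam : ℤ → ℂ` lists every eigenvalue exactly once. -/
def IsEigenvalueEnum (p q : ℝ → ℝ) (h₁ h₂ : ℝ) (lam : ℤ → ℂ) : Prop :=
  Function.Injective lam ∧ range lam = {z | IsEigenvalue p q h₁ h₂ z}

/-- A system of functions is complete in `L₂(0, π; ℂ²)`: its members lie in this space and their
finite linear combinations are dense in it. -/
def IsCompleteSystem {ι : Type*} (u : ι → ℝ → C2) : Prop :=
  ∃ hu : ∀ i, MemLp (u i) 2 mu,
    (Submodule.span ℂ (range fun i => ((hu i).toLp (u i) : Lp C2 2 mu))).topologicalClosure = ⊤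

end DiracBVP

end

/-! The eigenvectors of `L` form an orthogonal basis of the Hilbert space `H`, because a resolvent
of `L` at a real point is compact, symmetric and injective.

In integrated form the system is a Volterra equation in `C([0, π])` with a square integrable kernel
matrix. Its operator is quasinilpotent (`isUnit_one_sub_volterra`), so initial value problems are
uniquely solvable for every `z`, and `z` is an eigenvalue exactly when `φ(·, z)` satisfies the
condition at `π` (`isEigenvalue_iff`). The Lagrange identity makes `L` symmetric
(`IsInGraph.inner_eq`): the boundary terms at `π` are cancelled by the third component. Hence
eigenvalues are real and eigenvectors orthogonal; since `H` is separable there are countably many of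
them, and some real `μ` is not an eigenvalue. Correcting a particular solution by a multiple of
`φ(·, μ)` gives `(L - μ)⁻¹` (`eq_resolventC_iff`). It passes through the primitive map `L₂ → C([0,
π])`, which is compact by Arzelà–Ascoli, so the spectral theorem applies and its eigenvectors are
those of `L` (`eigenspace_resolventH_le`). This yields `eigenBasis`.

The `L₂` statements are the expansion and the Parseval equality of `(f, 0)` in `H`. For `Y` in
`D(L)`, the series of `(L - μ)Y` converges in `H`; the resolvent is continuous from `H` into `C([0,
π])`, and applying it gives the series of `Y`, now uniformly convergent.

The third coordinate is stored as `y₃ / √h₂`, which turns the weighted inner product into the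
standard one. -/

noncomputable section

namespace DiracBVP

/-! ### Absolutely continuous functions and their primitives -/

section AbsoluteContinuity

variable {F G : Type*} [NormedAddCommGroup F] [NormedAddCommGroup G]

/-- A function whose increments are dominated by those of an absolutely continuous function is
absolutely continuous. -/
lemma absolutelyContinuousOnInterval_of_dist_le {f : ℝ → F} {g : ℝ → G} {a b : ℝ}
    (hg : AbsolutelyContinuousOnInterval g a b)
    (h : ∀ s ∈ uIcc a b, ∀ t ∈ uIcc a b, dist (f s) (f t) ≤ dist (g s) (g t)) :
    AbsolutelyContinuousOnInterval f a b := by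
  rw [absolutelyContinuousOnInterval_iff] at hg ⊢
  intro ε hε
  obtain ⟨δ, hδ, H⟩ := hg ε hε
  refine ⟨δ, hδ, fun E hE hlt => lt_of_le_of_lt (Finset.sum_le_sum fun i hi => ?_) (H E hE hlt)⟩
  exact h _ (hE.1 i hi).1 _ (hE.1 i hi).2

lemma intervalIntegrable_of_integrable_mu {f : ℝ → F} (hf : Integrable f mu) {s t : ℝ}
    (hs : s ∈ Icc 0 π) (ht : t ∈ Icc 0 π) : IntervalIntegrable f volume s t := by
  have h : IntervalIntegrable f volume 0 π := by
    rw [intervalIntegrable_iff_integrableOn_Ioo_of_le Real.pi_pos.le]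
    exact hf
  refine h.mono_set ?_
  rw [uIcc_of_le Real.pi_pos.le]
  exact uIcc_subset_Icc hs ht

variable [NormedSpace ℝ F]

/-- The increments of the primitive of `g` are bounded by those of the primitive of `‖g‖`, which
reduces the vector valued case to the scalar one. -/
lemma absolutelyContinuousOnInterval_integral {g : ℝ → F} (hg : Integrable g mu) :
    AbsolutelyContinuousOnInterval (fun x => ∫ t in (0 : ℝ)..x, g t) 0 π := by
  have hn : IntervalIntegrable (fun t => ‖g t‖) volume 0 π :=
    intervalIntegrable_of_integrable_mu hg.norm (by simp [Real.pi_pos.le])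
      (by simp [Real.pi_pos.le])
  refine absolutelyContinuousOnInterval_of_dist_le
    (hn.absolutelyContinuousOnInterval_intervalIntegral (c := 0) (by simp)) ?_
  rw [uIcc_of_le Real.pi_pos.le]
  intro s hs t ht
  have h0 : (0 : ℝ) ∈ Icc 0 π := by simp [Real.pi_pos.le]
  have I := fun {u} (hu : u ∈ Icc 0 π) => intervalIntegrable_of_integrable_mu hg h0 hu
  have I' := fun {u} (hu : u ∈ Icc 0 π) => intervalIntegrable_of_integrable_mu hg.norm h0 hu
  rw [dist_eq_norm, dist_eq_norm, intervalIntegral.integral_interval_sub_left (I hs) (I ht),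
    intervalIntegral.integral_interval_sub_left (I' hs) (I' ht)]
  exact intervalIntegral.norm_integral_le_abs_integral_norm

lemma ae_mu_of_ae_mem_uIcc {P : ℝ → Prop} (h : ∀ᵐ x, x ∈ uIcc 0 π → P x) : ∀ᵐ x ∂mu, P x := by
  rw [ae_restrict_iff' measurableSet_Ioo]
  filter_upwards [h] with x hx hx'
  rw [uIcc_of_le Real.pi_pos.le] at hx
  exact hx (Ioo_subset_Icc_self hx')

lemma ae_mem_uIcc_of_ae_mu {P : ℝ → Prop} (h : ∀ᵐ x ∂mu, P x) : ∀ᵐ x, x ∈ uIcc 0 π → P x := by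
  rw [ae_restrict_iff' measurableSet_Ioo] at h
  have h0 : ∀ᵐ x : ℝ, x ≠ 0 := by simp [ae_iff, measure_singleton]
  have hπ : ∀ᵐ x : ℝ, x ≠ π := by simp [ae_iff, measure_singleton]
  filter_upwards [h, h0, hπ] with x hx h0 hπ hx'
  rw [uIcc_of_le Real.pi_pos.le] at hx'
  exact hx ⟨lt_of_le_of_ne hx'.1 h0.symm, lt_of_le_of_ne hx'.2 hπ⟩

lemma ae_mu_mem_Ioo : ∀ᵐ x ∂mu, x ∈ Ioo 0 π := ae_restrict_mem measurableSet_Ioo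

variable [CompleteSpace F]

lemma ae_hasDerivAt_integral_mu {g : ℝ → F} (hg : Integrable g mu) :
    ∀ᵐ x ∂mu, HasDerivAt (fun x => ∫ t in (0 : ℝ)..x, g t) (g x) x := by
  have h0 : (0 : ℝ) ∈ Icc 0 π := by simp [Real.pi_pos.le]
  have h := (intervalIntegrable_of_integrable_mu hg h0
    (by simp [Real.pi_pos.le] : π ∈ Icc 0 π)).ae_hasDerivAt_integral
  refine ae_mu_of_ae_mem_uIcc ?_
  filter_upwards [h] with x hx hx'
  exact hx hx' 0 (by simp)

/-- The fundamental theorem of calculus for absolutely continuous functions. -/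
lemma eq_add_integral_of_ae_hasDerivAt {f g : ℝ → F} (hf : AbsolutelyContinuousOnInterval f 0 π)
    (hg : Integrable g mu) (hd : ∀ᵐ x ∂mu, HasDerivAt f (g x) x) {x : ℝ} (hx : x ∈ Icc 0 π) :
    f x = f 0 + ∫ t in (0 : ℝ)..x, g t := by
  -- The difference of `f` and the primitive of `g` is absolutely continuous with derivative zero
  -- a.e., hence constant.
  obtain ⟨C, hC⟩ := (hf.fun_sub
    (absolutelyContinuousOnInterval_integral hg)).const_of_ae_hasDerivAt_zero (by
      refine ae_mem_uIcc_of_ae_mu ?_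
      filter_upwards [hd, ae_hasDerivAt_integral_mu hg] with x h1 h2
      simpa using h1.fun_sub h2)
  rw [uIcc_of_le Real.pi_pos.le] at hC
  have h1 := hC x hx
  have h2 := hC 0 (by simp [Real.pi_pos.le])
  simp only [intervalIntegral.integral_same, sub_zero] at h2
  rw [h2, ← h1]
  abel

end AbsoluteContinuity

lemma integral_mu_eq {F : Type*} [NormedAddCommGroup F] [NormedSpace ℝ F] {g : ℝ → F} :
    ∫ x, g x ∂mu = ∫ t in (0 : ℝ)..π, g t := by
  rw [intervalIntegral.integral_of_le Real.pi_pos.le, integral_Ioc_eq_integral_Ioo]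

lemma ae_differentiableAt_mu {f : ℝ → ℂ} (hf : AbsolutelyContinuousOnInterval f 0 π) :
    ∀ᵐ x ∂mu, DifferentiableAt ℝ f x :=
  ae_mu_of_ae_mem_uIcc hf.boundedVariationOn.ae_differentiableAt_of_mem_uIcc

lemma hasDerivAt_of_eqOn {f g : ℝ → ℂ} {g' : ℂ} {x : ℝ} (h : ∀ x ∈ Icc 0 π, f x = g x)
    (hx : x ∈ Ioo 0 π) (hg : HasDerivAt g g' x) : HasDerivAt f g' x :=
  hg.congr_of_eventuallyEq <| by
    filter_upwards [Ioo_mem_nhds hx.1 hx.2] with t ht using h t (Ioo_subset_Icc_self ht)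

lemma integral_apply {g : ℝ → C2} (hg : Integrable g mu) {x : ℝ} (hx : x ∈ Icc 0 π) (i : Fin 2) :
    (∫ t in (0 : ℝ)..x, g t) i = ∫ t in (0 : ℝ)..x, g t i :=
  ((EuclideanSpace.proj (𝕜 := ℂ) i).intervalIntegral_comp_comm
    (intervalIntegrable_of_integrable_mu hg (by simp [Real.pi_pos.le]) hx)).symm

lemma integrable_apply {g : ℝ → C2} (hg : Integrable g mu) (i : Fin 2) :
    Integrable (fun t => g t i) mu :=
  (EuclideanSpace.proj (𝕜 := ℂ) i : C2 →L[ℂ] ℂ).integrable_comp hg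

lemma isAC_of_eq_integral {y g : ℝ → C2} {c : C2} (hg : Integrable g mu)
    (h : ∀ x ∈ Icc 0 π, y x = c + ∫ t in (0 : ℝ)..x, g t) : IsAC y := by
  intro i
  refine absolutelyContinuousOnInterval_of_dist_le
    (absolutelyContinuousOnInterval_integral (integrable_apply hg i)) ?_
  rw [uIcc_of_le Real.pi_pos.le]
  intro s hs t ht
  simp only [h s hs, h t ht, PiLp.add_apply, integral_apply hg hs, integral_apply hg ht,
    dist_add_left, le_refl]

lemma ae_hasDerivAt_of_eq_integral {y g : ℝ → C2} {c : C2} (hg : Integrable g mu)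
    (h : ∀ x ∈ Icc 0 π, y x = c + ∫ t in (0 : ℝ)..x, g t) (i : Fin 2) :
    ∀ᵐ x ∂mu, HasDerivAt (fun t => y t i) (g x i) x := by
  filter_upwards [ae_hasDerivAt_integral_mu (integrable_apply hg i), ae_mu_mem_Ioo] with x h1 h2
  refine hasDerivAt_of_eqOn (g := fun t => c i + ∫ s in (0 : ℝ)..t, g s i) (fun t ht => ?_) h2
    (h1.const_add _)
  rw [h t ht, PiLp.add_apply, integral_apply hg ht]

lemma eq_integral_of_isAC {y g : ℝ → C2} (hy : IsAC y) (hg : Integrable g mu)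
    (hd : ∀ i, ∀ᵐ x ∂mu, deriv (fun t => y t i) x = g x i) {x : ℝ} (hx : x ∈ Icc 0 π) :
    y x = y 0 + ∫ t in (0 : ℝ)..x, g t := by
  ext i
  rw [PiLp.add_apply, integral_apply hg hx]
  refine eq_add_integral_of_ae_hasDerivAt (f := fun t => y t i) (hy i) (integrable_apply hg i) ?_ hx
  filter_upwards [hd i, ae_differentiableAt_mu (hy i)] with t h1 h2
  exact h1 ▸ h2.hasDerivAt

lemma IsAC.continuousOn {y : ℝ → C2} (hy : IsAC y) : ContinuousOn y (Icc 0 π) := by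
  have h : ∀ i, ContinuousOn (fun t => y t i) (Icc 0 π) := fun i => by
    simpa [uIcc_of_le Real.pi_pos.le] using (hy i).continuousOn
  exact (PiLp.continuous_toLp 2 _).comp_continuousOn (continuousOn_pi.2 h)

/-! ### The space `C([0, π])` and the compact primitive map -/

/-- The space `C([0, π], ℂ²)` with the supremum norm. -/
abbrev CIcc : Type := BoundedContinuousFunction (Icc (0 : ℝ) π) C2

/-- The restriction to `[0, π]` of a function which is continuous there. -/
def restrictIcc (y : ℝ → C2) (hy : ContinuousOn y (Icc 0 π)) : CIcc :=
  BoundedContinuousFunction.mkOfCompact ⟨(Icc 0 π).domRestrict y, hy.domRestrict⟩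

/-- The extension of a function on `[0, π]` to the real line, constant outside the interval. -/
def extend (y : CIcc) (t : ℝ) : C2 := y (projIcc 0 π Real.pi_pos.le t)

lemma zero_mem_Icc : (0 : ℝ) ∈ Icc 0 π := by simp [Real.pi_pos.le]

lemma pi_mem_Icc : π ∈ Icc 0 π := by simp [Real.pi_pos.le]

@[simp] lemma extend_coe (y : CIcc) (x : Icc (0 : ℝ) π) : extend y x = y x := by
  simp [extend]

@[simp] lemma extend_add (y z : CIcc) (t : ℝ) : extend (y + z) t = extend y t + extend z t := rfl

@[simp] lemma extend_smul (c : ℂ) (y : CIcc) (t : ℝ) : extend (c • y) t = c • extend y t := rfl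

@[simp] lemma extend_const (v : C2) (t : ℝ) :
    extend (BoundedContinuousFunction.const _ v) t = v := rfl

lemma extend_restrictIcc {y : ℝ → C2} (hy : ContinuousOn y (Icc 0 π)) {x : ℝ} (hx : x ∈ Icc 0 π) :
    extend (restrictIcc y hy) x = y x := by
  rw [extend, projIcc_of_mem _ hx]
  rfl

lemma extend_injective {y z : CIcc} (h : ∀ x ∈ Icc 0 π, extend y x = extend z x) : y = z := by
  ext1 x
  rw [← extend_coe, ← extend_coe, h x x.2]

lemma continuous_extend (y : CIcc) : Continuous (extend y) :=
  y.continuous.comp continuous_projIcc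

lemma norm_extend_le (y : CIcc) (t : ℝ) : ‖extend y t‖ ≤ ‖y‖ := y.norm_coe_le_norm _

lemma integrable_of_memLp {F : Type*} [NormedAddCommGroup F] {f : ℝ → F} (hf : MemLp f 2 mu) :
    Integrable f mu := hf.integrable one_le_two

/-- The Cauchy–Schwarz bound for the increments of a primitive. -/
lemma norm_integral_le_sqrt_mul (g : Lp C2 2 mu) {s t : ℝ} (hs : s ∈ Icc 0 π) (ht : t ∈ Icc 0 π) :
    ‖∫ x in s..t, g x‖ ≤ √|t - s| * ‖g‖ := by
  wlog hst : s ≤ t generalizing s t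
  · rw [intervalIntegral.integral_symm, norm_neg, abs_sub_comm]
    exact this ht hs (not_le.1 hst).le
  have hsub : Ioo s t ⊆ Ioo 0 π := Ioo_subset_Ioo hs.1 ht.2
  have hmu : volume.restrict (Ioo s t) ≤ mu := Measure.restrict_mono hsub le_rfl
  rw [intervalIntegral.integral_of_le hst, integral_Ioc_eq_integral_Ioo]
  have hm : MemLp g 2 (volume.restrict (Ioo s t)) := (Lp.memLp g).mono_measure hmu
  -- Cauchy–Schwarz, as the comparison of the `L₁` and `L₂` norms on a set of measure `t - s`.
  have h1 := eLpNorm_le_eLpNorm_mul_rpow_measure_univ (p := 1) (q := 2) one_le_two hm.1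
  have h2 : eLpNorm g 2 (volume.restrict (Ioo s t)) ≤ ENNReal.ofReal ‖g‖ := by
    rw [Lp.norm_def, ENNReal.ofReal_toReal (Lp.eLpNorm_ne_top g)]
    exact eLpNorm_mono_measure _ hmu
  have h3 : ENNReal.ofReal ‖∫ x in Ioo s t, g x‖ ≤
      ENNReal.ofReal (√|t - s| * ‖g‖) := by
    calc ENNReal.ofReal ‖∫ x in Ioo s t, g x‖ = ‖∫ x in Ioo s t, g x‖ₑ := ofReal_norm _
      _ ≤ ∫⁻ x in Ioo s t, ‖g x‖ₑ := enorm_integral_le_lintegral_enorm _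
      _ = eLpNorm g 1 (volume.restrict (Ioo s t)) := eLpNorm_one_eq_lintegral_enorm.symm
      _ ≤ _ := h1
      _ ≤ ENNReal.ofReal ‖g‖ * ENNReal.ofReal √|t - s| := by
        gcongr
        rw [Measure.restrict_apply_univ, Real.volume_Ioo, abs_of_nonneg (sub_nonneg.2 hst),
          ENNReal.ofReal_rpow_of_nonneg (sub_nonneg.2 hst) (by norm_num), Real.sqrt_eq_rpow]
        norm_num
      _ = _ := by rw [← ENNReal.ofReal_mul (norm_nonneg _), mul_comm]
  exact (ENNReal.ofReal_le_ofReal_iff (by positivity)).1 h3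

lemma intervalIntegrable_Lp (g : Lp C2 2 mu) {s t : ℝ} (hs : s ∈ Icc 0 π) (ht : t ∈ Icc 0 π) :
    IntervalIntegrable g volume s t :=
  intervalIntegrable_of_integrable_mu (integrable_of_memLp (Lp.memLp g)) hs ht

lemma intervalIntegral_congr_ae_mu {F : Type*} [NormedAddCommGroup F] [NormedSpace ℝ F]
    {f g : ℝ → F} (h : f =ᵐ[mu] g) {x : ℝ} (hx : x ∈ Icc 0 π) :
    ∫ t in (0 : ℝ)..x, f t = ∫ t in (0 : ℝ)..x, g t := by
  rw [intervalIntegral.integral_of_le hx.1, intervalIntegral.integral_of_le hx.1,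
    integral_Ioc_eq_integral_Ioo, integral_Ioc_eq_integral_Ioo]
  exact integral_congr_ae (ae_restrict_of_ae_restrict_of_subset (Ioo_subset_Ioo_right hx.2) h)

lemma continuousOn_primitive {F : Type*} [NormedAddCommGroup F] [NormedSpace ℝ F] {g : ℝ → F}
    (hg : Integrable g mu) :
    ContinuousOn (fun x => ∫ t in (0 : ℝ)..x, g t) (Icc 0 π) := by
  simpa [uIcc_of_le Real.pi_pos.le] using (absolutelyContinuousOnInterval_integral hg).continuousOn

/-- The primitive `x ↦ ∫₀ˣ g` as a continuous linear map from `L₂` to `C([0, π])`. -/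
def primitive : Lp C2 2 mu →L[ℂ] CIcc :=
  LinearMap.mkContinuous
    { toFun := fun g => restrictIcc (fun x => ∫ t in (0 : ℝ)..x, g t)
        (continuousOn_primitive (integrable_of_memLp (Lp.memLp g)))
      map_add' := fun f g => extend_injective fun x hx => by
        rw [extend_add, extend_restrictIcc _ hx, extend_restrictIcc _ hx, extend_restrictIcc _ hx,
          ← intervalIntegral.integral_add (intervalIntegrable_Lp f zero_mem_Icc hx)
            (intervalIntegrable_Lp g zero_mem_Icc hx)]
        exact intervalIntegral_congr_ae_mu (Lp.coeFn_add f g) hx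
      map_smul' := fun c g => extend_injective fun x hx => by
        rw [RingHom.id_apply, extend_smul, extend_restrictIcc _ hx, extend_restrictIcc _ hx,
          ← intervalIntegral.integral_smul]
        exact intervalIntegral_congr_ae_mu (Lp.coeFn_smul c g) hx }
    (√π) fun g => by
      rw [BoundedContinuousFunction.norm_le (by positivity)]
      intro x
      refine (norm_integral_le_sqrt_mul g zero_mem_Icc x.2).trans ?_
      gcongr
      rw [sub_zero, abs_of_nonneg x.2.1]
      exact x.2.2

lemma extend_primitive (g : Lp C2 2 mu) {x : ℝ} (hx : x ∈ Icc 0 π) :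
    extend (primitive g) x = ∫ t in (0 : ℝ)..x, g t :=
  extend_restrictIcc (continuousOn_primitive (integrable_of_memLp (Lp.memLp g))) hx

lemma dist_primitive_le (g : Lp C2 2 mu) (x z : Icc (0 : ℝ) π) :
    dist (primitive g x) (primitive g z) ≤ √(dist x z) * ‖g‖ := by
  rw [← extend_coe, ← extend_coe, extend_primitive g x.2, extend_primitive g z.2, dist_eq_norm,
    intervalIntegral.integral_interval_sub_left (intervalIntegrable_Lp g zero_mem_Icc x.2)
      (intervalIntegrable_Lp g zero_mem_Icc z.2)]
  exact norm_integral_le_sqrt_mul g z.2 x.2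

/-- Arzelà–Ascoli: the image of the unit ball is bounded and, by Cauchy–Schwarz, has the common
modulus of continuity `√r`. -/
lemma isCompactOperator_primitive : IsCompactOperator primitive := by
  rw [show (primitive : Lp C2 2 mu → CIcc) = (primitive : Lp C2 2 mu →ₗ[ℂ] CIcc) from rfl,
    isCompactOperator_iff_isCompact_closure_image_closedBall _ one_pos]
  refine BoundedContinuousFunction.arzela_ascoli (Metric.closedBall 0 ‖primitive‖)
    (isCompact_closedBall _ _) _ ?_ ?_
  · rintro _ x ⟨g, hg, rfl⟩
    rw [mem_closedBall_zero_iff] at hg ⊢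
    refine ((primitive g).norm_coe_le_norm x).trans ((primitive.le_opNorm g).trans ?_)
    exact mul_le_of_le_one_right (norm_nonneg _) hg
  · refine Metric.equicontinuous_of_continuity_modulus (fun r => √r) ?_ _ ?_
    · simpa using (Real.continuous_sqrt.tendsto 0)
    · rintro x z ⟨_, g, hg, rfl⟩
      rw [mem_closedBall_zero_iff] at hg
      exact (dist_primitive_le g x z).trans (mul_le_of_le_one_right (by positivity) hg)

lemma memLp_clm_apply_extend {A : ℝ → C2 →L[ℂ] C2} (hA : MemLp A 2 mu) (y : CIcc) :
    MemLp (fun t => A t (extend y t)) 2 mu := by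
  refine hA.of_le_mul (c := ‖y‖) ?_ ?_
  · exact (ContinuousLinearMap.id ℂ (C2 →L[ℂ] C2)).aestronglyMeasurable_comp₂ hA.1
      (continuous_extend y).aestronglyMeasurable
  · refine ae_of_all _ fun t => ((A t).le_opNorm _).trans ?_
    rw [mul_comm]
    gcongr
    exact norm_extend_le y t

/-! ### Volterra operators -/

/-- Multiplication by a square integrable matrix function, from `C([0, π])` to `L₂`. -/
def matMul (A : ℝ → C2 →L[ℂ] C2) (hA : MemLp A 2 mu) : CIcc →L[ℂ] Lp C2 2 mu :=
  LinearMap.mkContinuous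
    { toFun := fun y => (memLp_clm_apply_extend hA y).toLp _
      map_add' := fun y z => by
        rw [← MemLp.toLp_add]
        congr 1
        ext1 t
        simp
      map_smul' := fun c y => by
        rw [RingHom.id_apply, ← MemLp.toLp_const_smul]
        congr 1
        ext1 t
        simp }
    (eLpNorm A 2 mu).toReal fun y => by
      simp only [LinearMap.coe_mk, AddHom.coe_mk]
      rw [Lp.norm_toLp, mul_comm, ← ENNReal.toReal_ofReal (norm_nonneg y), ← ENNReal.toReal_mul]
      refine ENNReal.toReal_mono (ENNReal.mul_ne_top ENNReal.ofReal_ne_top hA.2.ne) ?_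
      refine eLpNorm_le_mul_eLpNorm_of_ae_le_mul (ae_of_all _ fun t => ?_) 2
      refine ((A t).le_opNorm _).trans ?_
      rw [mul_comm]
      gcongr
      exact norm_extend_le y t

lemma matMul_ae {A : ℝ → C2 →L[ℂ] C2} (hA : MemLp A 2 mu) (y : CIcc) :
    matMul A hA y =ᵐ[mu] fun t => A t (extend y t) :=
  (memLp_clm_apply_extend hA y).coeFn_toLp

/-- The Volterra operator `y ↦ ∫₀ˣ A y`. -/
def volterra (A : ℝ → C2 →L[ℂ] C2) (hA : MemLp A 2 mu) : CIcc →L[ℂ] CIcc :=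
  primitive ∘L matMul A hA

lemma extend_volterra {A : ℝ → C2 →L[ℂ] C2} (hA : MemLp A 2 mu) (y : CIcc) {x : ℝ}
    (hx : x ∈ Icc 0 π) :
    extend (volterra A hA y) x = ∫ t in (0 : ℝ)..x, A t (extend y t) := by
  rw [volterra, ContinuousLinearMap.comp_apply, extend_primitive _ hx]
  exact intervalIntegral_congr_ae_mu (matMul_ae hA y) hx

/-- With `α` the primitive of `a`, the absolutely continuous function `α ^ (n + 1)` has derivative
`(n + 1) a α ^ n` almost everywhere. This is the inductive step in bounding iterated Volterra
integrals. -/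
lemma integral_mul_primitive_pow {a : ℝ → ℝ} (ha : Integrable a mu) (n : ℕ) {x : ℝ}
    (hx : x ∈ Icc 0 π) :
    ∫ t in (0 : ℝ)..x, a t * (∫ s in (0 : ℝ)..t, a s) ^ n =
      (∫ s in (0 : ℝ)..x, a s) ^ (n + 1) / (n + 1) := by
  set α : ℝ → ℝ := fun t => ∫ s in (0 : ℝ)..t, a s with hα
  have hAC : AbsolutelyContinuousOnInterval α 0 π := absolutelyContinuousOnInterval_integral ha
  have hpow : ∀ k : ℕ, AbsolutelyContinuousOnInterval (fun t => α t ^ (k + 1)) 0 π := by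
    intro k
    induction k with
    | zero => simpa using hAC
    | succ k ih =>
      simp only [pow_succ _ (k + 1)]
      exact ih.fun_mul hAC
  obtain ⟨C, hC⟩ := hAC.exists_bound
  rw [uIcc_of_le Real.pi_pos.le] at hC
  have hint : Integrable (fun t => a t * α t ^ n) mu := by
    refine ha.mul_bdd (c := C ^ n) ?_ ?_
    · exact (((continuousOn_primitive ha).mono Ioo_subset_Icc_self).pow n).aestronglyMeasurable
        measurableSet_Ioo
    · filter_upwards [ae_mu_mem_Ioo] with t ht
      rw [norm_pow]
      exact pow_le_pow_left₀ (norm_nonneg _) (hC t (Ioo_subset_Icc_self ht)) n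
  have h := eq_add_integral_of_ae_hasDerivAt (hpow n) (hint.const_mul ((n : ℝ) + 1)) (by
    filter_upwards [ae_hasDerivAt_integral_mu ha] with t ht
    refine (ht.fun_pow (n + 1)).congr_deriv ?_
    push_cast
    simp only [hα]
    ring) hx
  rw [intervalIntegral.integral_const_mul] at h
  have h0 : α 0 = 0 := by simp [hα]
  simp only [h0, ne_eq, Nat.add_eq_zero_iff, one_ne_zero, and_false, not_false_eq_true, zero_pow,
    zero_add] at h
  have hn : (n : ℝ) + 1 ≠ 0 := by positivity
  rw [eq_div_iff hn, h]
  ring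

/-- The pointwise bound at `t < x`, rather than the norm of the previous iterate, is integrated;
this is what produces the factorial. -/
lemma norm_volterra_pow_le {A : ℝ → C2 →L[ℂ] C2} (hA : MemLp A 2 mu) (y : CIcc) (n : ℕ) {x : ℝ}
    (hx : x ∈ Icc 0 π) :
    ‖extend ((volterra A hA ^ n) y) x‖ ≤ ‖y‖ * ((∫ t in (0 : ℝ)..x, ‖A t‖) ^ n / n.factorial) := by
  have ha : Integrable (fun t => ‖A t‖) mu := (integrable_of_memLp hA).norm
  induction n generalizing x with
  | zero => simpa using norm_extend_le y x
  | succ n ih =>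
    rw [pow_succ', mul_apply_eq_comp, extend_volterra hA _ hx]
    have hsub : ∀ t ∈ Ioc 0 x, t ∈ Icc 0 π := fun t ht => ⟨ht.1.le, ht.2.trans hx.2⟩
    have hI : IntervalIntegrable
        (fun t => ‖y‖ / n.factorial * (‖A t‖ * (∫ s in (0 : ℝ)..t, ‖A s‖) ^ n)) volume 0 x := by
      refine IntervalIntegrable.const_mul ?_ _
      refine (intervalIntegrable_of_integrable_mu ha zero_mem_Icc hx).mul_continuousOn ?_
      rw [uIcc_of_le hx.1]
      exact ((continuousOn_primitive ha).mono (Icc_subset_Icc_right hx.2)).pow n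
    refine (intervalIntegral.norm_integral_le_of_norm_le hx.1 (ae_of_all _ fun t ht => ?_)
      hI).trans (le_of_eq ?_)
    · refine ((A t).le_opNorm _).trans ?_
      refine (mul_le_mul_of_nonneg_left (ih (hsub t ht)) (norm_nonneg _)).trans (le_of_eq ?_)
      ring
    · rw [intervalIntegral.integral_const_mul, integral_mul_primitive_pow ha n hx,
        Nat.factorial_succ]
      push_cast
      field_simp

/-- The factorization `1 - x ^ n = (1 - x) ∑ x ^ i` has commuting factors, so both are units. -/
lemma isUnit_one_sub_of_isUnit_one_sub_pow {R : Type*} [Ring R] {x : R} {n : ℕ}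
    (h : IsUnit (1 - x ^ n)) : IsUnit (1 - x) := by
  have hc : Commute (1 - x) (∑ i ∈ Finset.range n, x ^ i) :=
    Commute.sum_right _ _ _ fun i _ => (Commute.one_left _).sub_left (Commute.self_pow _ _)
  rw [← mul_neg_geom_sum, hc.isUnit_mul_iff] at h
  exact h.1

/-- Volterra operators are quasinilpotent. -/
lemma isUnit_one_sub_volterra {A : ℝ → C2 →L[ℂ] C2} (hA : MemLp A 2 mu) :
    IsUnit (1 - volterra A hA) := by
  have ha : Integrable (fun t => ‖A t‖) mu := (integrable_of_memLp hA).norm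
  set M := ∫ t in (0 : ℝ)..π, ‖A t‖
  -- Some power has norm at most `M ^ n / n! < 1`, and the Neumann series inverts `1` minus that
  -- power.
  obtain ⟨n, hn⟩ := ((FloorSemiring.tendsto_pow_div_factorial_atTop M).eventually
    (gt_mem_nhds one_pos)).exists
  have hM : 0 ≤ M := intervalIntegral.integral_nonneg Real.pi_pos.le fun t _ => norm_nonneg _
  have hlt : ‖volterra A hA ^ n‖ < 1 := by
    refine (ContinuousLinearMap.opNorm_le_bound _ (by positivity) fun y => ?_).trans_lt hn
    rw [BoundedContinuousFunction.norm_le (by positivity), mul_comm]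
    intro x
    rw [← extend_coe]
    refine (norm_volterra_pow_le hA y n x.2).trans ?_
    gcongr
    · exact intervalIntegral.integral_nonneg x.2.1 fun t _ => norm_nonneg _
    · exact intervalIntegral.integral_mono_interval le_rfl x.2.1 x.2.2
        (ae_of_all _ fun t => norm_nonneg _)
        (intervalIntegrable_of_integrable_mu ha zero_mem_Icc pi_mem_Icc)
  have hu : IsUnit (1 - volterra A hA ^ n) :=
    isUnit_one_sub_of_norm_lt_one (R := CIcc →L[ℂ] CIcc) hlt
  exact isUnit_one_sub_of_isUnit_one_sub_pow (R := CIcc →L[ℂ] CIcc) hu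

/-! ### The Dirac system as a Volterra equation -/

/-- The linear map of `ℂ²` with matrix `(a b; c d)`. -/
def matrixCLM (a b c d : ℂ) : C2 →L[ℂ] C2 :=
  LinearMap.toContinuousLinearMap
    { toFun := fun v => !₂[a * v 0 + b * v 1, c * v 0 + d * v 1]
      map_add' := fun v w => by
        ext i
        fin_cases i <;> simp <;> ring
      map_smul' := fun r v => by
        ext i
        fin_cases i <;> simp <;> ring }

@[simp] lemma matrixCLM_apply_zero (a b c d : ℂ) (v : C2) :
    matrixCLM a b c d v 0 = a * v 0 + b * v 1 := rfl

@[simp] lemma matrixCLM_apply_one (a b c d : ℂ) (v : C2) :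
    matrixCLM a b c d v 1 = c * v 0 + d * v 1 := rfl

/-- The matrix `(0 -1; 1 0)`, the inverse of `B = (0 1; -1 0)`. -/
def rotation : C2 →L[ℂ] C2 := matrixCLM 0 (-1) 1 0

@[simp] lemma rotation_apply_zero (v : C2) : rotation v 0 = -v 1 := by simp [rotation]

@[simp] lemma rotation_apply_one (v : C2) : rotation v 1 = v 0 := by simp [rotation]

/-- The coefficient matrix of the system `l(y) = z y` in normal form `y' = A y`. -/
def coeffMatrix (p q : ℝ → ℝ) (z : ℂ) (t : ℝ) : C2 →L[ℂ] C2 :=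
  (q t : ℂ) • matrixCLM 1 0 0 (-1) + (p t : ℂ) • matrixCLM 0 (-1) (-1) 0 + z • rotation

lemma coeffMatrix_apply_zero (p q : ℝ → ℝ) (z : ℂ) (t : ℝ) (v : C2) :
    coeffMatrix p q z t v 0 = q t * v 0 - p t * v 1 - z * v 1 := by
  simp [coeffMatrix]
  ring

lemma coeffMatrix_apply_one (p q : ℝ → ℝ) (z : ℂ) (t : ℝ) (v : C2) :
    coeffMatrix p q z t v 1 = -(p t * v 0) - q t * v 1 + z * v 0 := by
  simp [coeffMatrix]
  ring

lemma coeffMatrix_eq_add (p q : ℝ → ℝ) (z : ℂ) (t : ℝ) :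
    coeffMatrix p q z t = coeffMatrix p q 0 t + z • rotation := by
  ext v i
  fin_cases i
  · simp [coeffMatrix_apply_zero]
    ring
  · simp [coeffMatrix_apply_one]

lemma memLp_ofReal_smul {E : Type*} [NormedAddCommGroup E] [NormedSpace ℂ E] {r : ℝ → ℝ}
    (hr : MemLp r 2 mu) (S : E) : MemLp (fun t => (r t : ℂ) • S) 2 mu := by
  have hr' : MemLp (fun t => (r t : ℂ)) 2 mu := hr.ofReal
  exact (ContinuousLinearMap.toSpanSingleton ℂ S).comp_memLp' hr'

lemma memLp_linear_combination {E : Type*} [NormedAddCommGroup E] [NormedSpace ℂ E] {p q : ℝ → ℝ}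
    (hp : MemLp p 2 mu) (hq : MemLp q 2 mu) (S₁ S₂ S₃ : E) :
    MemLp (fun t => (q t : ℂ) • S₁ + (p t : ℂ) • S₂ + S₃) 2 mu :=
  ((memLp_ofReal_smul hq S₁).add (memLp_ofReal_smul hp S₂)).add (memLp_const S₃)

lemma memLp_coeffMatrix {p q : ℝ → ℝ} (hp : MemLp p 2 mu) (hq : MemLp q 2 mu) (z : ℂ) :
    MemLp (coeffMatrix p q z) 2 mu :=
  memLp_linear_combination hp hq _ _ _

/-- The embedding of `C([0, π])` into `L₂`. -/
def toL2 : CIcc →L[ℂ] Lp C2 2 mu :=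
  matMul (fun _ => ContinuousLinearMap.id ℂ C2) (memLp_const _)

lemma toL2_ae (y : CIcc) : toL2 y =ᵐ[mu] extend y := matMul_ae _ y

/-- Continuous functions that agree almost everywhere on the interval agree everywhere on it. -/
lemma toL2_injective {y : CIcc} (h : toL2 y = 0) : y = 0 := by
  have h1 : extend y =ᵐ[mu] fun _ => (0 : C2) := by
    refine (toL2_ae y).symm.trans ?_
    rw [h]
    exact Lp.coeFn_zero _ _ _
  refine extend_injective fun x hx => ?_
  have h2 : extend y =ᵐ[volume.restrict (Icc 0 π)] fun _ => (0 : C2) := by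
    rwa [← restrict_Ioo_eq_restrict_Icc]
  exact Measure.eqOn_Icc_of_ae_eq volume Real.pi_pos.ne h2 (continuous_extend y).continuousOn
    continuousOn_const hx

/-- Pointwise application of `rotation` to the elements of `L₂`. -/
def rotationL2 : Lp C2 2 mu →L[ℂ] Lp C2 2 mu := rotation.compLpL 2 mu

lemma rotationL2_ae (g : Lp C2 2 mu) : rotationL2 g =ᵐ[mu] fun t => rotation (g t) :=
  rotation.coeFn_compLpL g

section System

variable {p q : ℝ → ℝ} (hp : MemLp p 2 mu) (hq : MemLp q 2 mu)

/-- The integrated form of the equation `l(y) = w`. -/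
def IsPotential (y : CIcc) (w : Lp C2 2 mu) : Prop :=
  y = BoundedContinuousFunction.const _ (extend y 0)
    + volterra _ (memLp_coeffMatrix hp hq 0) y + primitive (rotationL2 w)

lemma integrable_rhs (hp : MemLp p 2 mu) (hq : MemLp q 2 mu) (y : CIcc) (w : Lp C2 2 mu) :
    Integrable (fun t => coeffMatrix p q 0 t (extend y t) + rotation (w t)) mu :=
  (integrable_of_memLp (memLp_clm_apply_extend (memLp_coeffMatrix hp hq 0) y)).add
    (integrable_of_memLp (rotation.comp_memLp' (Lp.memLp w)))

lemma extend_volterra_add_primitive (y : CIcc) (w : Lp C2 2 mu) {x : ℝ} (hx : x ∈ Icc 0 π) :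
    extend (volterra _ (memLp_coeffMatrix hp hq 0) y) x + extend (primitive (rotationL2 w)) x =
      ∫ t in (0 : ℝ)..x, (coeffMatrix p q 0 t (extend y t) + rotation (w t)) := by
  rw [extend_volterra _ _ hx, extend_primitive _ hx,
    intervalIntegral_congr_ae_mu (rotationL2_ae w) hx, intervalIntegral.integral_add]
  · exact intervalIntegrable_of_integrable_mu
      (integrable_of_memLp (memLp_clm_apply_extend (memLp_coeffMatrix hp hq 0) y)) zero_mem_Icc hx
  · exact intervalIntegrable_of_integrable_mu
      (integrable_of_memLp (rotation.comp_memLp' (Lp.memLp w))) zero_mem_Icc hx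

lemma isPotential_iff {y : CIcc} {w : Lp C2 2 mu} : IsPotential hp hq y w ↔
    ∀ x ∈ Icc 0 π, extend y x = extend y 0 +
      ∫ t in (0 : ℝ)..x, (coeffMatrix p q 0 t (extend y t) + rotation (w t)) := by
  constructor
  · intro h x hx
    rw [← extend_volterra_add_primitive hp hq y w hx, ← add_assoc]
    exact congrArg (fun u : CIcc => extend u x) h
  · refine fun h => extend_injective fun x hx => ?_
    rw [h x hx, ← extend_volterra_add_primitive hp hq y w hx, extend_add, extend_add, extend_const,
      add_assoc]

lemma IsPotential.isAC {y : CIcc} {w : Lp C2 2 mu} (h : IsPotential hp hq y w) :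
    IsAC (extend y) :=
  isAC_of_eq_integral (integrable_rhs hp hq y w) ((isPotential_iff hp hq).1 h)

lemma IsPotential.ae_hasDerivAt_zero {y : CIcc} {w : Lp C2 2 mu} (h : IsPotential hp hq y w) :
    ∀ᵐ x ∂mu, HasDerivAt (fun t => extend y t 0)
      (q x * extend y x 0 - p x * extend y x 1 - w x 1) x := by
  filter_upwards [ae_hasDerivAt_of_eq_integral (integrable_rhs hp hq y w)
    ((isPotential_iff hp hq).1 h) 0] with x hx
  refine hx.congr_deriv ?_
  simp [coeffMatrix_apply_zero]
  ring

lemma IsPotential.ae_hasDerivAt_one {y : CIcc} {w : Lp C2 2 mu} (h : IsPotential hp hq y w) :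
    ∀ᵐ x ∂mu, HasDerivAt (fun t => extend y t 1)
      (-(p x * extend y x 0) - q x * extend y x 1 + w x 0) x := by
  filter_upwards [ae_hasDerivAt_of_eq_integral (integrable_rhs hp hq y w)
    ((isPotential_iff hp hq).1 h) 1] with x hx
  refine hx.congr_deriv ?_
  simp [coeffMatrix_apply_one]

lemma IsPotential.ae_diracExpr {y : CIcc} {w : Lp C2 2 mu} (h : IsPotential hp hq y w) :
    ∀ᵐ x ∂mu, diracExpr p q (extend y) x = w x := by
  filter_upwards [h.ae_hasDerivAt_zero hp hq, h.ae_hasDerivAt_one hp hq] with x h0 h1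
  ext i
  fin_cases i
  · simp [diracExpr, h1.deriv]
    ring
  · simp [diracExpr, h0.deriv]
    ring

lemma isPotential_restrictIcc {y : ℝ → C2} (hy : IsAC y) {w : Lp C2 2 mu}
    (h : diracExpr p q y =ᵐ[mu] w) : IsPotential hp hq (restrictIcc y hy.continuousOn) w := by
  set u := restrictIcc y hy.continuousOn
  have hu : ∀ x ∈ Icc 0 π, extend u x = y x := fun x hx => extend_restrictIcc _ hx
  rw [isPotential_iff]
  intro x hx
  rw [hu x hx, hu 0 zero_mem_Icc]
  refine eq_integral_of_isAC hy (integrable_rhs hp hq u w) (fun i => ?_) hx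
  filter_upwards [h, ae_mu_mem_Ioo] with t ht ht'
  rw [hu t (Ioo_subset_Icc_self ht')]
  have h0 := congrArg (fun v : C2 => v 0) ht
  have h1 := congrArg (fun v : C2 => v 1) ht
  simp only [diracExpr, Fin.isValue, PiLp.toLp_apply, Matrix.cons_val_zero, Matrix.cons_val_one]
    at h0 h1
  fin_cases i
  · simp [coeffMatrix_apply_zero, ← h1]
  · simp [coeffMatrix_apply_one, ← h0]

/-- The term `z y` is moved to the right-hand side, so that `l(y) = z y + g` becomes an instance of
`IsPotential`, which does not involve `z`. -/
lemma volterra_coeffMatrix (z : ℂ) (y : CIcc) :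
    volterra _ (memLp_coeffMatrix hp hq z) y =
      volterra _ (memLp_coeffMatrix hp hq 0) y + primitive (rotationL2 (z • toL2 y)) := by
  simp only [volterra, ContinuousLinearMap.comp_apply, ← map_add]
  congr 1
  refine Lp.ext ?_
  filter_upwards [matMul_ae (memLp_coeffMatrix hp hq z) y, matMul_ae (memLp_coeffMatrix hp hq 0) y,
    rotationL2_ae (z • toL2 y), toL2_ae y, Lp.coeFn_smul z (toL2 y),
    Lp.coeFn_add (matMul _ (memLp_coeffMatrix hp hq 0) y) (rotationL2 (z • toL2 y))]
    with t h1 h2 h3 h4 h5 h6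
  rw [h1, h6, Pi.add_apply, h2, h3, h5, Pi.smul_apply, h4, coeffMatrix_eq_add]
  simp

@[simp] lemma extend_primitive_zero (g : Lp C2 2 mu) : extend (primitive g) 0 = 0 := by
  rw [extend_primitive _ zero_mem_Icc, intervalIntegral.integral_same]

@[simp] lemma extend_volterra_zero {A : ℝ → C2 →L[ℂ] C2} (hA : MemLp A 2 mu) (y : CIcc) :
    extend (volterra A hA y) 0 = 0 := extend_primitive_zero _

/-- The solution operator of the Volterra equation `y = f + ∫₀ˣ A y`. -/
def solve (z : ℂ) : CIcc →L[ℂ] CIcc :=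
  Ring.inverse (1 - volterra _ (memLp_coeffMatrix hp hq z))

lemma eq_solve_iff {z : ℂ} {y f : CIcc} :
    y = solve hp hq z f ↔ y = f + volterra _ (memLp_coeffMatrix hp hq z) y := by
  have hu := isUnit_one_sub_volterra (memLp_coeffMatrix hp hq z)
  have h1 := Ring.mul_inverse_cancel _ hu
  have h2 := Ring.inverse_mul_cancel _ hu
  rw [← sub_eq_iff_eq_add]
  constructor
  · rintro rfl
    exact congrArg (fun S : CIcc →L[ℂ] CIcc => S f) h1
  · rintro rfl
    exact (congrArg (fun S : CIcc →L[ℂ] CIcc => S y) h2).symm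

/-- `solve` yields the solution of the initial value problem `l(y) = z y + g`, `y(0) = v`. -/
lemma eq_solve_const_add_iff {z : ℂ} {y : CIcc} {v : C2} {g : Lp C2 2 mu} :
    y = solve hp hq z (BoundedContinuousFunction.const _ v + primitive (rotationL2 g)) ↔
      extend y 0 = v ∧ IsPotential hp hq y (g + z • toL2 y) := by
  rw [eq_solve_iff, volterra_coeffMatrix hp hq, IsPotential, map_add, map_add]
  constructor
  · intro h
    have h0 : extend y 0 = v := by
      have := congrArg (fun u : CIcc => extend u 0) h
      simpa using this
    refine ⟨h0, ?_⟩
    rw [h0]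
    nth_rewrite 1 [h]
    abel
  · rintro ⟨rfl, h⟩
    nth_rewrite 1 [h]
    abel

/-- The solution `φ(·, z)` as an element of `C([0, π])`. -/
def phiC (z : ℂ) : CIcc := solve hp hq z (BoundedContinuousFunction.const _ !₂[0, -1])

lemma eq_phiC_iff {z : ℂ} {y : CIcc} :
    y = phiC hp hq z ↔ extend y 0 = !₂[0, -1] ∧ IsPotential hp hq y (z • toL2 y) := by
  have h := eq_solve_const_add_iff hp hq (z := z) (y := y) (v := !₂[0, -1]) (g := 0)
  simpa [phiC] using h

lemma isSolution_of_isPotential {z : ℂ} {y : CIcc} (h : IsPotential hp hq y (z • toL2 y)) :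
    IsSolution p q z (extend y) := by
  refine ⟨h.isAC, ?_⟩
  filter_upwards [h.ae_diracExpr, Lp.coeFn_smul z (toL2 y), toL2_ae y] with x h1 h2 h3
  rw [h1, h2, Pi.smul_apply, h3]

lemma toL2_restrictIcc_ae {y : ℝ → C2} (hy : ContinuousOn y (Icc 0 π)) :
    toL2 (restrictIcc y hy) =ᵐ[mu] y := by
  filter_upwards [toL2_ae (restrictIcc y hy), ae_mu_mem_Ioo] with x h1 h2
  rw [h1, extend_restrictIcc _ (Ioo_subset_Icc_self h2)]

lemma IsSolution.isPotential {z : ℂ} {y : ℝ → C2} (h : IsSolution p q z y) :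
    IsPotential hp hq (restrictIcc y h.1.continuousOn)
      (z • toL2 (restrictIcc y h.1.continuousOn)) := by
  refine isPotential_restrictIcc hp hq h.1 ?_
  filter_upwards [h.2, Lp.coeFn_smul z (toL2 (restrictIcc y h.1.continuousOn)),
    toL2_restrictIcc_ae h.1.continuousOn] with x h1 h2 h3
  rw [h1, h2, Pi.smul_apply, h3]

/-- The solutions `φ(·, z)` exist. -/
lemma isPhi_phi (hp : MemLp p 2 mu) (hq : MemLp q 2 mu) (z : ℂ) : IsPhi p q z (phi p q z) := by
  have h := (eq_phiC_iff hp hq (z := z)).1 rfl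
  exact Classical.epsilon_spec (p := IsPhi p q z)
    ⟨extend (phiC hp hq z), isSolution_of_isPotential hp hq h.2, h.1⟩

/-- The solution `φ(·, z)` is unique on `[0, π]`. -/
lemma phi_eq_phiC (z : ℂ) {x : ℝ} (hx : x ∈ Icc 0 π) : phi p q z x = extend (phiC hp hq z) x := by
  have h := isPhi_phi hp hq z
  have h1 : restrictIcc _ h.1.1.continuousOn = phiC hp hq z := by
    rw [eq_phiC_iff, extend_restrictIcc _ zero_mem_Icc]
    exact ⟨h.2, h.1.isPotential hp hq⟩
  rw [← h1, extend_restrictIcc _ hx]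

lemma phi_ae (z : ℂ) : phi p q z =ᵐ[mu] toL2 (phiC hp hq z) := by
  filter_upwards [toL2_ae (phiC hp hq z), ae_mu_mem_Ioo] with x h1 h2
  rw [h1, phi_eq_phiC hp hq z (Ioo_subset_Icc_self h2)]

lemma phiC_apply_zero (z : ℂ) : extend (phiC hp hq z) 0 = !₂[0, -1] := ((eq_phiC_iff hp hq).1 rfl).1

lemma isPotential_phiC (z : ℂ) : IsPotential hp hq (phiC hp hq z) (z • toL2 (phiC hp hq z)) :=
  ((eq_phiC_iff hp hq).1 rfl).2

lemma toL2_phiC_ne_zero (z : ℂ) : toL2 (phiC hp hq z) ≠ 0 := by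
  intro h
  have h0 := phiC_apply_zero hp hq z
  rw [toL2_injective h] at h0
  have := congrArg (fun v : C2 => v 1) h0
  simp [extend] at this

end System

/-! ### Symmetry of `L` and the eigenvalues -/

/-- The value at `π` of a component. -/
def endpoint (i : Fin 2) : CIcc →L[ℂ] ℂ :=
  (EuclideanSpace.proj (𝕜 := ℂ) i : C2 →L[ℂ] ℂ) ∘L
    BoundedContinuousFunction.evalCLM ℂ (⟨π, pi_mem_Icc⟩ : Icc (0 : ℝ) π)

lemma endpoint_apply (i : Fin 2) (y : CIcc) : endpoint i y = extend y π i := by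
  rw [extend, projIcc_of_mem _ pi_mem_Icc]
  rfl

lemma absolutelyContinuousOnInterval_conj {f : ℝ → ℂ} (hf : AbsolutelyContinuousOnInterval f 0 π) :
    AbsolutelyContinuousOnInterval (fun x => conj (f x)) 0 π :=
  absolutelyContinuousOnInterval_of_dist_le hf fun s _ t _ => by
    rw [Complex.dist_conj_conj]

lemma hasDerivAt_conj {f : ℝ → ℂ} {f' : ℂ} {x : ℝ} (h : HasDerivAt f f' x) :
    HasDerivAt (fun x => conj (f x)) (conj f') x :=
  Complex.conjCLE.toContinuousLinearMap.hasFDerivAt.comp_hasDerivAt x h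

lemma inner_C2 (u w : C2) : inner ℂ u w = w 0 * conj (u 0) + w 1 * conj (u 1) := by
  simp [PiLp.inner_apply, Fin.sum_univ_two, RCLike.inner_apply]

section System

variable {p q : ℝ → ℝ} (hp : MemLp p 2 mu) (hq : MemLp q 2 mu)

/-- The Lagrange identity for the Dirac differential expression. -/
lemma lagrange_identity {y u : CIcc} {w v : Lp C2 2 mu} (hy : IsPotential hp hq y w)
    (hu : IsPotential hp hq u v) (hy0 : extend y 0 0 = 0) (hu0 : extend u 0 0 = 0) :
    inner ℂ (toL2 u) w - inner ℂ v (toL2 y) =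
      endpoint 1 y * conj (endpoint 0 u) - endpoint 0 y * conj (endpoint 1 u) := by
  have hi : Integrable (fun x => inner ℂ (toL2 u x) (w x) - inner ℂ (v x) (toL2 y x)) mu :=
    (L2.integrable_inner _ _).sub (L2.integrable_inner _ _)
  have hAC : AbsolutelyContinuousOnInterval (fun x => extend y x 1 * conj (extend u x 0)
      - extend y x 0 * conj (extend u x 1)) 0 π :=
    ((hy.isAC hp hq 1).fun_smul (absolutelyContinuousOnInterval_conj (hu.isAC hp hq 0))).fun_sub
      ((hy.isAC hp hq 0).fun_smul (absolutelyContinuousOnInterval_conj (hu.isAC hp hq 1)))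
  -- The Wronskian-type expression `y₂ conj(u₁) - y₁ conj(u₂)` has the difference of the two
  -- integrands as derivative; the terms with `p` and `q` cancel because these are real. At `0` it
  -- vanishes.
  have h := eq_add_integral_of_ae_hasDerivAt hAC hi (by
    filter_upwards [hy.ae_hasDerivAt_zero hp hq, hy.ae_hasDerivAt_one hp hq,
      hu.ae_hasDerivAt_zero hp hq, hu.ae_hasDerivAt_one hp hq, toL2_ae y, toL2_ae u]
      with x h1 h2 h3 h4 h5 h6
    refine ((h2.fun_mul (hasDerivAt_conj h3)).fun_sub
      (h1.fun_mul (hasDerivAt_conj h4))).congr_deriv ?_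
    rw [h5, h6, inner_C2, inner_C2]
    simp only [map_sub, map_add, map_mul, map_neg, Complex.conj_ofReal]
    ring) pi_mem_Icc
  rw [L2.inner_def, L2.inner_def, ← integral_sub (L2.integrable_inner _ _)
    (L2.integrable_inner _ _), integral_mu_eq]
  simp only [endpoint_apply]
  rw [h, hy0, hu0]
  simp

/-- The Hilbert space `L₂(0, π; ℂ²) ⊕ ℂ`; the last coordinate is rescaled by `√h₂`. -/
abbrev HSpace : Type := WithLp 2 (Lp C2 2 mu × ℂ)

variable (h₁ h₂ : ℝ)

/-- The element `(y, y₁(π) / √h₂)` of the Hilbert space. -/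
def embed : CIcc →L[ℂ] HSpace :=
  (WithLp.prodContinuousLinearEquiv 2 ℂ (Lp C2 2 mu) ℂ).symm.toContinuousLinearMap ∘L
    (toL2.prod ((√h₂ : ℂ)⁻¹ • endpoint 0))

@[simp] lemma embed_fst (y : CIcc) : (embed h₂ y).fst = toL2 y := rfl

@[simp] lemma embed_snd (y : CIcc) : (embed h₂ y).snd = (√h₂ : ℂ)⁻¹ * endpoint 0 y := rfl

lemma embed_injective {y : CIcc} (h : embed h₂ y = 0) : y = 0 :=
  toL2_injective (by rw [← embed_fst h₂, h]; rfl)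

/-- The last component `-h₁ y₁(π) - h₂ y₂(π)` of the operator `L`. -/
def boundary : CIcc →L[ℂ] ℂ := -((h₁ : ℂ) • endpoint 0) - (h₂ : ℂ) • endpoint 1

lemma boundary_apply (y : CIcc) :
    boundary h₁ h₂ y = -(h₁ * endpoint 0 y) - h₂ * endpoint 1 y := rfl

/-- `(y, y₁(π))` belongs to the domain of `L` and is mapped to `X`. -/
structure IsInGraph (y : CIcc) (X : HSpace) : Prop where
  zero : extend y 0 0 = 0
  isPotential : IsPotential hp hq y X.fst
  boundary_eq : (√h₂ : ℂ) * X.snd = boundary h₁ h₂ y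

variable {h₁ h₂}

lemma ofReal_sqrt_ne_zero (hh₂ : 0 < h₂) : (√h₂ : ℂ) ≠ 0 := by
  rw [Complex.ofReal_ne_zero]
  positivity

lemma ofReal_sqrt_mul_self (hh₂ : 0 < h₂) : (√h₂ : ℂ) * √h₂ = h₂ := by
  rw [← Complex.ofReal_mul, Real.mul_self_sqrt hh₂.le]

/-- The operator `L` is symmetric. -/
lemma IsInGraph.inner_eq (hh₂ : 0 < h₂) {y u : CIcc} {X U : HSpace}
    (hy : IsInGraph hp hq h₁ h₂ y X) (hu : IsInGraph hp hq h₁ h₂ u U) :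
    inner ℂ (embed h₂ u) X = inner ℂ U (embed h₂ y) := by
  have h := lagrange_identity hp hq hy.isPotential hu.isPotential hy.zero hu.zero
  have hs := ofReal_sqrt_ne_zero hh₂
  have hs2 := ofReal_sqrt_mul_self hh₂
  have hX : X.snd = (√h₂ : ℂ)⁻¹ * boundary h₁ h₂ y := by
    rw [← hy.boundary_eq, inv_mul_cancel_left₀ hs]
  have hU : U.snd = (√h₂ : ℂ)⁻¹ * boundary h₁ h₂ u := by
    rw [← hu.boundary_eq, inv_mul_cancel_left₀ hs]
  rw [WithLp.prod_inner_apply, WithLp.prod_inner_apply]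
  change inner ℂ (toL2 u) X.fst + inner ℂ ((√h₂ : ℂ)⁻¹ * endpoint 0 u) X.snd =
    inner ℂ U.fst (toL2 y) + inner ℂ U.snd ((√h₂ : ℂ)⁻¹ * endpoint 0 y)
  rw [sub_eq_iff_eq_add] at h
  rw [h, hX, hU, RCLike.inner_apply, RCLike.inner_apply, boundary_apply, boundary_apply]
  simp only [map_mul, map_inv₀, Complex.conj_ofReal, map_sub, map_neg]
  field_simp
  rw [pow_two, hs2]
  ring

lemma isInGraph_phiC_iff (hh₂ : 0 < h₂) {z : ℂ} :
    IsInGraph hp hq h₁ h₂ (phiC hp hq z) (z • embed h₂ (phiC hp hq z)) ↔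
      boundary h₁ h₂ (phiC hp hq z) = z * endpoint 0 (phiC hp hq z) := by
  have hs := ofReal_sqrt_ne_zero hh₂
  have hb : (√h₂ : ℂ) * (z • embed h₂ (phiC hp hq z)).snd = z * endpoint 0 (phiC hp hq z) := by
    rw [WithLp.smul_snd, embed_snd, smul_eq_mul]
    field_simp
  constructor
  · intro h
    rw [← h.boundary_eq, hb]
  · exact fun h => ⟨by simp [phiC_apply_zero], isPotential_phiC hp hq z, by rw [hb, h]⟩

/-- A solution of `l(y) = z y`, `y₁(0) = 0` is a multiple of `φ(·, z)`. -/
lemma eq_smul_phiC {z : ℂ} {y : CIcc} (hy : IsPotential hp hq y (z • toL2 y))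
    (h0 : extend y 0 0 = 0) : y = (-extend y 0 1) • phiC hp hq z := by
  -- Uniqueness for the homogeneous initial value problem, with `g = 0`.
  have h1 := (eq_solve_const_add_iff hp hq (z := z) (v := extend y 0) (g := 0)).2
    ⟨rfl, by simpa using hy⟩
  rw [map_zero, map_zero, add_zero] at h1
  rw [phiC, ← map_smul]
  refine h1.trans ?_
  congr 1
  ext x i
  fin_cases i
  · simpa using h0
  · simp

/-- Solutions with `y₁(0) = 0` are multiples of `φ(·, z)`, so only the condition at `π` remains to
be tested, on `φ(·, z)` itself. -/
lemma isEigenvalue_iff {z : ℂ} : IsEigenvalue p q h₁ h₂ z ↔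
    boundary h₁ h₂ (phiC hp hq z) = z * endpoint 0 (phiC hp hq z) := by
  constructor
  · rintro ⟨y, hy, ⟨x, hx, hne⟩, h0, hπ⟩
    have hu := hy.isPotential hp hq
    set u := restrictIcc y hy.1.continuousOn with hu_def
    have hext : ∀ x ∈ Icc 0 π, extend u x = y x := fun x hx => extend_restrictIcc _ hx
    have h1 := eq_smul_phiC hp hq hu (by rw [hext 0 zero_mem_Icc, h0])
    set c := -extend u 0 1
    have hc : c ≠ 0 := by
      intro hc
      apply hne
      rw [← hext x hx, h1, extend_smul, hc, zero_smul]
    rw [← hext π pi_mem_Icc, ← endpoint_apply, ← endpoint_apply, h1, map_smul, map_smul,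
      smul_eq_mul, smul_eq_mul] at hπ
    refine mul_left_cancel₀ hc ?_
    rw [boundary_apply]
    linear_combination -hπ
  · intro h
    refine ⟨extend (phiC hp hq z), isSolution_of_isPotential hp hq (isPotential_phiC hp hq z),
      ⟨0, zero_mem_Icc, fun h0 => ?_⟩, by simp [phiC_apply_zero], ?_⟩
    · rw [phiC_apply_zero] at h0
      simpa using congrArg (fun v : C2 => v 1) h0
    · rw [← endpoint_apply, ← endpoint_apply]
      rw [boundary_apply] at h
      linear_combination -h

lemma embed_phiC_ne_zero (z : ℂ) : embed h₂ (phiC hp hq z) ≠ 0 := fun h =>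
  toL2_phiC_ne_zero hp hq z (by rw [embed_injective h₂ h, map_zero])

lemma IsEigenvalue.isInGraph (hh₂ : 0 < h₂) {z : ℂ} (hz : IsEigenvalue p q h₁ h₂ z) :
    IsInGraph hp hq h₁ h₂ (phiC hp hq z) (z • embed h₂ (phiC hp hq z)) :=
  (isInGraph_phiC_iff hp hq hh₂).2 ((isEigenvalue_iff hp hq).1 hz)

/-- Symmetry of `L` applied to one eigenvector paired with itself. -/
lemma IsEigenvalue.conj_eq (hp : MemLp p 2 mu) (hq : MemLp q 2 mu) (hh₂ : 0 < h₂) {z : ℂ}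
    (hz : IsEigenvalue p q h₁ h₂ z) : conj z = z := by
  have h := (hz.isInGraph hp hq hh₂).inner_eq hp hq hh₂ (hz.isInGraph hp hq hh₂)
  rw [inner_smul_left, inner_smul_right] at h
  exact (mul_right_cancel₀ (inner_self_ne_zero.2 (embed_phiC_ne_zero hp hq z)) h).symm

lemma IsEigenvalue.inner_eq_zero (hh₂ : 0 < h₂) {z z' : ℂ} (hz : IsEigenvalue p q h₁ h₂ z)
    (hz' : IsEigenvalue p q h₁ h₂ z') (hne : z ≠ z') :
    inner ℂ (embed h₂ (phiC hp hq z)) (embed h₂ (phiC hp hq z')) = 0 := by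
  have h := (hz'.isInGraph hp hq hh₂).inner_eq hp hq hh₂ (hz.isInGraph hp hq hh₂)
  rw [inner_smul_left, inner_smul_right, hz.conj_eq hp hq hh₂] at h
  by_contra h0
  exact hne (mul_right_cancel₀ h0 h).symm

/-! ### The resolvent and its spectral theory -/

/-- The solution of `l(y) = z y + g` with `y(0) = 0`. -/
def particular (z : ℂ) : Lp C2 2 mu →L[ℂ] CIcc := solve hp hq z ∘L primitive ∘L rotationL2

lemma particular_add_smul_phiC (z c : ℂ) (g : Lp C2 2 mu) :
    particular hp hq z g + c • phiC hp hq z = solve hp hq z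
      (BoundedContinuousFunction.const _ (c • !₂[0, -1]) + primitive (rotationL2 g)) := by
  rw [map_add, add_comm, phiC, ← map_smul]
  rfl

variable (h₁ h₂)

/-- The last component of `L - z`. -/
def boundarySub (z : ℂ) : CIcc →L[ℂ] ℂ := boundary h₁ h₂ - z • endpoint 0

lemma boundarySub_apply (z : ℂ) (y : CIcc) :
    boundarySub h₁ h₂ z y = boundary h₁ h₂ y - z * endpoint 0 y := rfl

/-- The coefficient of `φ(·, z)` in the solution of `(L - z) Y = X`. -/
def resolventCoeff (z : ℂ) : HSpace →L[ℂ] ℂ :=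
  (boundarySub h₁ h₂ z (phiC hp hq z))⁻¹ •
    ((√h₂ : ℂ) • WithLp.sndL 2 ℂ (Lp C2 2 mu) ℂ
      - boundarySub h₁ h₂ z ∘L particular hp hq z ∘L WithLp.fstL 2 ℂ (Lp C2 2 mu) ℂ)

lemma resolventCoeff_apply (z : ℂ) (X : HSpace) : resolventCoeff hp hq h₁ h₂ z X =
    (boundarySub h₁ h₂ z (phiC hp hq z))⁻¹ *
      (√h₂ * X.snd - boundarySub h₁ h₂ z (particular hp hq z X.fst)) := rfl

/-- The solution of `(L - z) Y = X` as an element of `C([0, π])`. -/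
def resolventC (z : ℂ) : HSpace →L[ℂ] CIcc :=
  particular hp hq z ∘L WithLp.fstL 2 ℂ (Lp C2 2 mu) ℂ
    + (resolventCoeff hp hq h₁ h₂ z).smulRight (phiC hp hq z)

lemma resolventC_apply (z : ℂ) (X : HSpace) : resolventC hp hq h₁ h₂ z X =
    particular hp hq z X.fst + resolventCoeff hp hq h₁ h₂ z X • phiC hp hq z := rfl

/-- The first summand factors through the compact primitive map; the second has rank at most one. -/
lemma isCompactOperator_resolventC (z : ℂ) : IsCompactOperator (resolventC hp hq h₁ h₂ z) := by
  have h1 : IsCompactOperator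
      (particular hp hq z ∘L WithLp.fstL 2 ℂ (Lp C2 2 mu) ℂ : HSpace →L[ℂ] CIcc) :=
    ((isCompactOperator_primitive.comp_clm rotationL2).comp_clm
      (WithLp.fstL 2 ℂ (Lp C2 2 mu) ℂ)).clm_comp (solve hp hq z)
  have h2 := (isCompactOperator_of_locallyCompactSpace_rng
    (ContinuousLinearMap.toSpanSingleton ℂ (phiC hp hq z))).comp_clm (resolventCoeff hp hq h₁ h₂ z)
  exact h1.add h2

variable {h₁ h₂}

/-- Every solution of `l(y) = z y + g` with `y₁(0) = 0` is the particular one plus `c φ(·, z)`. The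
last component of `(L - z)Y = X` is then a linear equation for `c`, whose leading coefficient is
nonzero because `z` is not an eigenvalue. -/
lemma eq_resolventC_iff (hh₂ : 0 < h₂) {z : ℂ} (hz : ¬ IsEigenvalue p q h₁ h₂ z) {y : CIcc}
    {X : HSpace} : y = resolventC hp hq h₁ h₂ z X ↔
      IsInGraph hp hq h₁ h₂ y (X + z • embed h₂ y) := by
  have hs := ofReal_sqrt_ne_zero hh₂
  have hne : boundarySub h₁ h₂ z (phiC hp hq z) ≠ 0 := by
    rw [boundarySub_apply, sub_ne_zero]
    exact fun h => hz ((isEigenvalue_iff hp hq).2 h)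
  have hb : (√h₂ : ℂ) * (X + z • embed h₂ y).snd = boundary h₁ h₂ y ↔
      boundarySub h₁ h₂ z y = √h₂ * X.snd := by
    rw [WithLp.add_snd, WithLp.smul_snd, embed_snd, smul_eq_mul, boundarySub_apply, mul_add,
      mul_left_comm z, mul_inv_cancel_left₀ hs, sub_eq_iff_eq_add, eq_comm]
  have hfst : (X + z • embed h₂ y).fst = X.fst + z • toL2 y := rfl
  constructor
  · intro h
    have h' := h
    rw [resolventC_apply, particular_add_smul_phiC, eq_solve_const_add_iff] at h'
    refine ⟨by simp [h'.1], by rw [hfst]; exact h'.2, hb.2 ?_⟩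
    rw [h, resolventC_apply, map_add, map_smul, resolventCoeff_apply, smul_eq_mul]
    field_simp
    ring
  · rintro ⟨h0, hpot, hbd⟩
    rw [hb] at hbd
    rw [hfst] at hpot
    have hv : extend y 0 = (-extend y 0 1) • !₂[0, -1] := by
      ext i
      fin_cases i
      · simpa using h0
      · simp
    have h1 := (eq_solve_const_add_iff hp hq).2 ⟨hv, hpot⟩
    rw [← particular_add_smul_phiC] at h1
    have h2 : -extend y 0 1 = resolventCoeff hp hq h₁ h₂ z X := by
      have h3 := congrArg (boundarySub h₁ h₂ z) h1
      rw [hbd, map_add, map_smul, smul_eq_mul] at h3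
      rw [resolventCoeff_apply, h3]
      field_simp
      ring
    rw [resolventC_apply, ← h2]
    exact h1

/-- The resolvent `(L - z)⁻¹`. -/
def resolventH (hp : MemLp p 2 mu) (hq : MemLp q 2 mu) (h₁ h₂ : ℝ) (z : ℂ) : HSpace →L[ℂ] HSpace :=
  embed h₂ ∘L resolventC hp hq h₁ h₂ z

lemma resolventH_apply (z : ℂ) (X : HSpace) :
    resolventH hp hq h₁ h₂ z X = embed h₂ (resolventC hp hq h₁ h₂ z X) := rfl

lemma isCompactOperator_resolventH (z : ℂ) : IsCompactOperator (resolventH hp hq h₁ h₂ z) :=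
  (isCompactOperator_resolventC hp hq h₁ h₂ z).clm_comp (embed h₂)

lemma resolventC_isInGraph (hh₂ : 0 < h₂) {z : ℂ} (hz : ¬ IsEigenvalue p q h₁ h₂ z) (X : HSpace) :
    IsInGraph hp hq h₁ h₂ (resolventC hp hq h₁ h₂ z X) (X + z • resolventH hp hq h₁ h₂ z X) :=
  (eq_resolventC_iff hp hq hh₂ hz).1 rfl

lemma isSymmetric_resolventH (hh₂ : 0 < h₂) {μ : ℝ} (hμ : ¬ IsEigenvalue p q h₁ h₂ μ) :
    (resolventH hp hq h₁ h₂ μ).IsSymmetric := by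
  intro X U
  have h := (resolventC_isInGraph hp hq hh₂ hμ U).inner_eq hp hq hh₂
    (resolventC_isInGraph hp hq hh₂ hμ X)
  rw [← resolventH_apply, ← resolventH_apply, inner_add_left, inner_add_right, inner_smul_left,
    inner_smul_right, Complex.conj_ofReal] at h
  exact add_right_cancel h

/-- The graph is that of a single-valued operator; this is what makes the resolvent injective. -/
lemma isInGraph_zero {X : HSpace} (hh₂ : 0 < h₂) (h : IsInGraph hp hq h₁ h₂ 0 X) : X = 0 := by
  have h1 : X.fst = 0 := by
    refine Lp.ext ?_
    filter_upwards [h.isPotential.ae_diracExpr, Lp.coeFn_zero C2 2 mu] with x h2 h3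
    rw [← h2, h3]
    ext i
    fin_cases i <;> simp [diracExpr, extend]
  have h2 : X.snd = 0 := by
    have := h.boundary_eq
    rw [map_zero] at this
    exact (mul_eq_zero.1 this).resolve_left (ofReal_sqrt_ne_zero hh₂)
  exact WithLp.ofLp_injective 2 (Prod.ext h1 h2)

lemma resolventH_injective (hh₂ : 0 < h₂) {z : ℂ} (hz : ¬ IsEigenvalue p q h₁ h₂ z) {X : HSpace}
    (h : resolventH hp hq h₁ h₂ z X = 0) : X = 0 := by
  have h1 := resolventC_isInGraph hp hq hh₂ hz X
  have h2 : resolventC hp hq h₁ h₂ z X = 0 := embed_injective h₂ h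
  rw [h, smul_zero, add_zero, h2] at h1
  exact isInGraph_zero hp hq hh₂ h1

/-- If `(L - μ)⁻¹ X = τ X` with `τ ≠ 0`, then `X` solves the eigenvalue equation of `L` at `τ⁻¹ +
μ`; for `τ = 0` injectivity leaves only `X = 0`. -/
lemma eigenspace_resolventH_le (hh₂ : 0 < h₂) {μ : ℂ} (hμ : ¬ IsEigenvalue p q h₁ h₂ μ) (τ : ℂ) :
    Module.End.eigenspace (resolventH hp hq h₁ h₂ μ : HSpace →ₗ[ℂ] HSpace) τ ≤
      Submodule.span ℂ (range fun z : {z // IsEigenvalue p q h₁ h₂ z} =>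
        embed h₂ (phiC hp hq z)) := by
  intro X hX
  have hX' : resolventH hp hq h₁ h₂ μ X = τ • X := Module.End.mem_eigenspace_iff.1 hX
  by_cases hτ : τ = 0
  · rw [hτ, zero_smul] at hX'
    rw [resolventH_injective hp hq hh₂ hμ hX']
    exact Submodule.zero_mem _
  set y := resolventC hp hq h₁ h₂ μ X with hy
  have hXy : X = τ⁻¹ • embed h₂ y := by
    rw [hy, ← resolventH_apply, hX', inv_smul_smul₀ hτ]
  have hg : IsInGraph hp hq h₁ h₂ y ((τ⁻¹ + μ) • embed h₂ y) := by
    have := resolventC_isInGraph hp hq hh₂ hμ X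
    rwa [resolventH_apply, ← hy, hXy, ← add_smul] at this
  set z := τ⁻¹ + μ
  have h1 := eq_smul_phiC hp hq (z := z) hg.isPotential hg.zero
  set c := -extend y 0 1
  by_cases hc : c = 0
  · have : X = 0 := by
      rw [hXy, h1, map_smul, hc, zero_smul, smul_zero]
    rw [this]
    exact Submodule.zero_mem _
  have hz : IsEigenvalue p q h₁ h₂ z := by
    rw [isEigenvalue_iff hp hq]
    have h2 := hg.boundary_eq
    rw [WithLp.smul_snd, embed_snd, smul_eq_mul, mul_left_comm,
      mul_inv_cancel_left₀ (ofReal_sqrt_ne_zero hh₂), h1, map_smul, map_smul, smul_eq_mul,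
      smul_eq_mul] at h2
    refine mul_left_cancel₀ hc ?_
    linear_combination -h2
  rw [hXy, h1, map_smul]
  exact Submodule.smul_mem _ _ (Submodule.smul_mem _ _ (Submodule.subset_span ⟨⟨z, hz⟩, rfl⟩))

/-- The eigenvectors of `L` have dense span. -/
lemma orthogonal_span_eigenvectors_eq_bot (hh₂ : 0 < h₂) {μ : ℝ}
    (hμ : ¬ IsEigenvalue p q h₁ h₂ μ) :
    (Submodule.span ℂ (range fun z : {z // IsEigenvalue p q h₁ h₂ z} =>
        embed h₂ (phiC hp hq z)))ᗮ = ⊥ := by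
  -- The spectral theorem: the eigenspaces of a compact symmetric operator have trivial joint
  -- orthogonal complement. Passing to the larger span of eigenvectors of `L` only shrinks the
  -- complement.
  rw [eq_bot_iff, ← ContinuousLinearMap.orthogonalComplement_iSup_eigenspaces_eq_bot
    (isCompactOperator_resolventH hp hq (h₁ := h₁) (h₂ := h₂) μ)
    (isSymmetric_resolventH hp hq hh₂ hμ)]
  exact Submodule.orthogonal_le (iSup_le fun τ => eigenspace_resolventH_le hp hq hh₂ hμ τ)

end System

/-! ### The orthogonal basis of eigenvectors -/

lemma l2Inner_eq {f g : ℝ → C2} {F G : Lp C2 2 mu} (hf : f =ᵐ[mu] F) (hg : g =ᵐ[mu] G) :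
    l2Inner f g = inner ℂ G F := by
  rw [L2.inner_def, l2Inner]
  refine integral_congr_ae ?_
  filter_upwards [hf, hg] with x h1 h2
  rw [h1, h2, inner_C2]

lemma hasSum_of_eq {ι E : Type*} [AddCommMonoid E] [TopologicalSpace E] {f g : ι → E} {a : E}
    (hfg : ∀ i, f i = g i) (h : HasSum g a) : HasSum f a := by
  rwa [show f = g from funext hfg]

/-- An orthonormal family in a separable inner product space is countable. -/
lemma countable_of_orthonormal {ι E : Type*} [NormedAddCommGroup E] [InnerProductSpace ℂ E]
    [TopologicalSpace.SeparableSpace E] {v : ι → E} (hv : Orthonormal ℂ v) : Countable ι := by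
  refine Pairwise.countable_of_isOpen_disjoint (s := fun i => Metric.ball (v i) (1 / 2)) ?_
    (fun i => Metric.isOpen_ball) (fun i => ⟨v i, by simp⟩)
  intro i j hij
  refine Metric.ball_disjoint_ball ?_
  -- Distinct members are at distance `√2 > 1`, so the balls of radius `1 / 2` are disjoint.
  have h : ‖v i - v j‖ ^ 2 = 2 := by
    rw [@norm_sub_sq ℂ, hv.1 i, hv.1 j, hv.2 hij]
    norm_num
  rw [dist_eq_norm]
  nlinarith [norm_nonneg (v i - v j)]

section Expansion

variable {p q : ℝ → ℝ} {h₁ h₂ : ℝ} (hp : MemLp p 2 mu) (hq : MemLp q 2 mu)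

lemma phi_pi_eq (hp : MemLp p 2 mu) (hq : MemLp q 2 mu) (z : ℂ) :
    phi p q z π 0 = endpoint 0 (phiC hp hq z) := by
  rw [phi_eq_phiC hp hq z pi_mem_Icc, endpoint_apply]

lemma hInner_phiH_eq (hh₂ : 0 < h₂) (z : ℂ) {Y : (ℝ → C2) × ℂ} {X : HSpace}
    (h1 : Y.1 =ᵐ[mu] X.fst) (h2 : X.snd = (√h₂ : ℂ)⁻¹ * Y.2) :
    hInner h₂ Y (phiH p q z) = inner ℂ (embed h₂ (phiC hp hq z)) X := by
  rw [WithLp.prod_inner_apply]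
  change l2Inner Y.1 (phi p q z) + 1 / (h₂ : ℂ) * Y.2 * conj (phi p q z π 0) =
    inner ℂ (toL2 (phiC hp hq z)) X.fst
      + inner ℂ ((√h₂ : ℂ)⁻¹ * endpoint 0 (phiC hp hq z)) X.snd
  rw [l2Inner_eq h1 (phi_ae hp hq z), phi_pi_eq hp hq, h2, RCLike.inner_apply,
    ← ofReal_sqrt_mul_self hh₂]
  have hs := ofReal_sqrt_ne_zero hh₂
  simp only [map_mul, map_inv₀, Complex.conj_ofReal]
  field_simp

lemma alpha_eq_norm_sq (hh₂ : 0 < h₂) (z : ℂ) :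
    alpha p q h₂ z = ‖embed h₂ (phiC hp hq z)‖ ^ 2 := by
  have h : (alpha p q h₂ z : ℂ) = hInner h₂ (phiH p q z) (phiH p q z) := by
    rw [alpha, hInner, l2Inner, Complex.ofReal_add, ← integral_complex_ofReal]
    simp only [phiH, mul_assoc, Complex.mul_conj']
    push_cast
    rfl
  rw [hInner_phiH_eq hp hq hh₂ z (X := embed h₂ (phiC hp hq z)) (phi_ae hp hq z)
    (by rw [embed_snd, phiH, phi_pi_eq hp hq]), inner_self_eq_norm_sq_to_K] at h
  exact Complex.ofReal_injective (h.trans (Complex.ofReal_pow _ _).symm)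

variable {ι : Type*} {lam : ι → ℂ}

/-- The normalized eigenvectors. -/
def unitEigenvector (h₂ : ℝ) (z : ℂ) : HSpace :=
  ((‖embed h₂ (phiC hp hq z)‖ : ℂ)⁻¹) • embed h₂ (phiC hp hq z)

lemma ofReal_norm_embed_ne_zero (z : ℂ) : (‖embed h₂ (phiC hp hq z)‖ : ℂ) ≠ 0 := by
  rw [Complex.ofReal_ne_zero, norm_ne_zero_iff]
  exact embed_phiC_ne_zero hp hq z

lemma orthonormal_unitEigenvector (hh₂ : 0 < h₂) (hinj : Function.Injective lam)
    (hlam : ∀ i, IsEigenvalue p q h₁ h₂ (lam i)) :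
    Orthonormal ℂ fun i => unitEigenvector hp hq h₂ (lam i) := by
  constructor
  · intro i
    change ‖unitEigenvector hp hq h₂ (lam i)‖ = 1
    rw [unitEigenvector, norm_smul, norm_inv, Complex.norm_real, norm_norm, inv_mul_cancel₀]
    exact norm_ne_zero_iff.2 (embed_phiC_ne_zero hp hq _)
  · intro i j hij
    change inner ℂ (unitEigenvector hp hq h₂ (lam i)) (unitEigenvector hp hq h₂ (lam j)) = 0
    rw [unitEigenvector, unitEigenvector, inner_smul_left, inner_smul_right,
      (hlam i).inner_eq_zero hp hq hh₂ (hlam j) (hinj.ne hij), mul_zero, mul_zero]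

lemma countable_eigenvalues (hp : MemLp p 2 mu) (hq : MemLp q 2 mu) (hh₂ : 0 < h₂) :
    Countable {z // IsEigenvalue p q h₁ h₂ z} := by
  have : Fact ((2 : ℝ≥0∞) ≠ ∞) := ⟨ENNReal.ofNat_ne_top⟩
  exact countable_of_orthonormal
    (orthonormal_unitEigenvector hp hq hh₂ Subtype.val_injective fun z => z.2)

/-- The real line is uncountable, while the eigenvalues are countable. -/
lemma exists_real_not_isEigenvalue (hp : MemLp p 2 mu) (hq : MemLp q 2 mu) (hh₂ : 0 < h₂) :
    ∃ μ : ℝ, ¬ IsEigenvalue p q h₁ h₂ μ := by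
  by_contra! h
  have := countable_eigenvalues (h₁ := h₁) hp hq hh₂
  have hinj : Function.Injective
      (fun r : ℝ => (⟨r, h r⟩ : {z // IsEigenvalue p q h₁ h₂ z})) := fun r s hrs =>
    Complex.ofReal_injective (congrArg Subtype.val hrs)
  exact not_countable (α := ℝ) hinj.countable

/-- The normalized eigenvectors form a Hilbert basis. -/
def eigenBasis (hh₂ : 0 < h₂) (hinj : Function.Injective lam)
    (hlam : range lam = {z | IsEigenvalue p q h₁ h₂ z}) : HilbertBasis ι ℂ HSpace :=
  HilbertBasis.mkOfOrthogonalEqBot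
    (orthonormal_unitEigenvector hp hq hh₂ hinj fun i => hlam.subset (mem_range_self i)) (by
      obtain ⟨μ, hμ⟩ := exists_real_not_isEigenvalue (h₁ := h₁) hp hq hh₂
      rw [eq_bot_iff, ← orthogonal_span_eigenvectors_eq_bot hp hq hh₂ hμ]
      refine Submodule.orthogonal_le (Submodule.span_le.2 ?_)
      rintro _ ⟨⟨z, hz⟩, rfl⟩
      obtain ⟨i, rfl⟩ := hlam.superset hz
      have h : embed h₂ (phiC hp hq (lam i)) =
          (‖embed h₂ (phiC hp hq (lam i))‖ : ℂ) • unitEigenvector hp hq h₂ (lam i) := by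
        rw [unitEigenvector, smul_inv_smul₀ (ofReal_norm_embed_ne_zero hp hq _)]
      change embed h₂ (phiC hp hq (lam i)) ∈ _
      rw [h]
      exact Submodule.smul_mem _ _ (Submodule.subset_span ⟨i, rfl⟩))

lemma eigenBasis_apply (hh₂ : 0 < h₂) (hinj : Function.Injective lam)
    (hlam : range lam = {z | IsEigenvalue p q h₁ h₂ z}) (i : ι) :
    eigenBasis hp hq hh₂ hinj hlam i = unitEigenvector hp hq h₂ (lam i) := by
  rw [eigenBasis, HilbertBasis.coe_mkOfOrthogonalEqBot]

/-- The Fourier coefficient of `X` with respect to an eigenvector. -/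
def fourierCoeff (h₂ : ℝ) (X : HSpace) (z : ℂ) : ℂ :=
  inner ℂ (embed h₂ (phiC hp hq z)) X / (alpha p q h₂ z : ℂ)

lemma coeffH_eq (hh₂ : 0 < h₂) (z : ℂ) {Y : (ℝ → C2) × ℂ} {X : HSpace}
    (h1 : Y.1 =ᵐ[mu] X.fst) (h2 : X.snd = (√h₂ : ℂ)⁻¹ * Y.2) :
    coeffH p q h₂ Y z = fourierCoeff hp hq h₂ X z := by
  rw [coeffH, hInner_phiH_eq hp hq hh₂ z h1 h2, fourierCoeff]

lemma hasSum_fourierCoeff (hh₂ : 0 < h₂) (hinj : Function.Injective lam)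
    (hlam : range lam = {z | IsEigenvalue p q h₁ h₂ z}) (X : HSpace) :
    HasSum (fun i => fourierCoeff hp hq h₂ X (lam i) • embed h₂ (phiC hp hq (lam i))) X := by
  refine hasSum_of_eq (fun i => ?_) ((eigenBasis hp hq hh₂ hinj hlam).hasSum_repr X)
  rw [HilbertBasis.repr_apply_apply, eigenBasis_apply, unitEigenvector, inner_smul_left, smul_smul,
    fourierCoeff, alpha_eq_norm_sq hp hq hh₂]
  congr 1
  rw [map_inv₀, Complex.conj_ofReal]
  push_cast
  field_simp

lemma hasSum_parseval (hh₂ : 0 < h₂) (hinj : Function.Injective lam)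
    (hlam : range lam = {z | IsEigenvalue p q h₁ h₂ z}) (X : HSpace) :
    HasSum (fun i => alpha p q h₂ (lam i) * ‖fourierCoeff hp hq h₂ X (lam i)‖ ^ 2) (‖X‖ ^ 2) := by
  have h := (eigenBasis hp hq hh₂ hinj hlam).hasSum_inner_mul_inner X X
  rw [inner_self_eq_norm_sq_to_K] at h
  refine Complex.hasSum_ofReal.1 ?_
  rw [Complex.ofReal_pow]
  refine hasSum_of_eq (fun i => ?_) h
  have hne := ofReal_norm_embed_ne_zero (h₂ := h₂) hp hq (lam i)
  rw [← inner_conj_symm, Complex.ofReal_mul, Complex.ofReal_pow, ← Complex.conj_mul', eigenBasis_apply, unitEigenvector, inner_smul_left,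
    fourierCoeff, alpha_eq_norm_sq hp hq hh₂]
  simp only [map_mul, map_pow, map_inv₀, map_div₀, Complex.conj_ofReal, Complex.ofReal_pow]
  field_simp

/-- With finitely many eigenvalues every element of `H` would have the form `(y, y₁(π) / √h₂)` with
`y` continuous. The element `(0, 1)` does not: a continuous `y` that is zero in `L₂` vanishes at
`π`. -/
lemma infinite_eigenvalues (hp : MemLp p 2 mu) (hq : MemLp q 2 mu) (hh₂ : 0 < h₂) :
    Infinite {z // IsEigenvalue p q h₁ h₂ z} := by
  by_contra hfin
  rw [not_infinite_iff_finite] at hfin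
  have := Fintype.ofFinite {z // IsEigenvalue p q h₁ h₂ z}
  set X : HSpace := WithLp.toLp 2 (0, 1) with hX
  have h := hasSum_fourierCoeff hp hq hh₂ (h₁ := h₁)
    (lam := fun z : {z // IsEigenvalue p q h₁ h₂ z} => z.1) Subtype.val_injective
    Subtype.range_coe X
  have h1 := h.unique (hasSum_fintype _)
  simp only [← map_smul, ← map_sum] at h1
  set y : CIcc := ∑ z : {z // IsEigenvalue p q h₁ h₂ z},
    fourierCoeff hp hq h₂ X z.1 • phiC hp hq z.1
  have h2 : toL2 y = 0 := (congrArg WithLp.fst h1).symm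
  have h3 : (1 : ℂ) = (√h₂ : ℂ)⁻¹ * endpoint 0 y := congrArg WithLp.snd h1
  rw [toL2_injective h2, map_zero, mul_zero] at h3
  exact one_ne_zero h3

lemma exists_isEigenvalueEnum (hp : MemLp p 2 mu) (hq : MemLp q 2 mu) (hh₂ : 0 < h₂) :
    ∃ lam : ℤ → ℂ, IsEigenvalueEnum p q h₁ h₂ lam := by
  have := countable_eigenvalues (h₁ := h₁) hp hq hh₂
  have := infinite_eigenvalues (h₁ := h₁) hp hq hh₂
  obtain ⟨e⟩ := nonempty_equiv_of_countable (α := ℤ) (β := {z // IsEigenvalue p q h₁ h₂ z})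
  refine ⟨fun n => (e n).1, Subtype.val_injective.comp e.injective, ?_⟩
  rw [show (fun n => (e n).1) = Subtype.val ∘ e from rfl, e.surjective.range_comp]
  exact Subtype.range_coe

/-! ### Expansion and Parseval equality in `L₂` -/

/-- The element `(f, 0)` of the Hilbert space. -/
def inclL2 (f : ℝ → C2) (hf : MemLp f 2 mu) : HSpace := WithLp.toLp 2 (hf.toLp f, 0)

lemma coeff_eq (hh₂ : 0 < h₂) (z : ℂ) {f : ℝ → C2} (hf : MemLp f 2 mu) :
    coeff p q h₂ f z = fourierCoeff hp hq h₂ (inclL2 f hf) z := by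
  rw [← coeffH_eq hp hq hh₂ z (Y := (f, 0)) (X := inclL2 f hf) hf.coeFn_toLp.symm
    (by rw [mul_zero]; rfl)]
  simp [coeff, coeffH, hInner, phiH]

/-- The expansion of `(f, 0)` in `H`, projected to the first component. -/
lemma hasSum_coeff (hh₂ : 0 < h₂) (hinj : Function.Injective lam)
    (hlam : range lam = {z | IsEigenvalue p q h₁ h₂ z}) {f : ℝ → C2} (hf : MemLp f 2 mu) :
    HasSum (fun i => coeff p q h₂ f (lam i) • toL2 (phiC hp hq (lam i))) (hf.toLp f) := by
  have h := (hasSum_fourierCoeff hp hq hh₂ hinj hlam (inclL2 f hf)).mapL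
    (WithLp.fstL 2 ℂ (Lp C2 2 mu) ℂ)
  simp only [map_smul, ← coeff_eq hp hq hh₂] at h
  exact h

lemma tendsto_eLpNorm_expansion (hp : MemLp p 2 mu) (hq : MemLp q 2 mu) (hh₂ : 0 < h₂)
    (hinj : Function.Injective lam)
    (hlam : range lam = {z | IsEigenvalue p q h₁ h₂ z}) {f : ℝ → C2} (hf : MemLp f 2 mu) :
    Tendsto (fun s : Finset ι => eLpNorm
      (fun x => f x - ∑ i ∈ s, coeff p q h₂ f (lam i) • phi p q (lam i) x) 2 mu) atTop (𝓝 0) := by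
  have h := hasSum_coeff hp hq hh₂ hinj hlam hf
  rw [HasSum, SummationFilter.unconditional_filter, tendsto_iff_edist_tendsto_0] at h
  refine h.congr fun s => ?_
  rw [edist_comm, edist_eq_enorm_sub, Lp.enorm_def]
  refine eLpNorm_congr_ae ?_
  have h1 : ∀ᵐ x ∂mu, ∀ i ∈ s, (coeff p q h₂ f (lam i) • toL2 (phiC hp hq (lam i))) x =
      coeff p q h₂ f (lam i) • phi p q (lam i) x := by
    rw [Finset.eventually_all]
    intro i _
    filter_upwards [Lp.coeFn_smul (coeff p q h₂ f (lam i)) (toL2 (phiC hp hq (lam i))),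
      phi_ae hp hq (lam i)] with x h2 h3
    rw [h2, Pi.smul_apply, h3]
  filter_upwards [Lp.coeFn_sub (hf.toLp f)
    (∑ i ∈ s, coeff p q h₂ f (lam i) • toL2 (phiC hp hq (lam i))), hf.coeFn_toLp,
    Lp.coeFn_finsetSum s (fun i => coeff p q h₂ f (lam i) • toL2 (phiC hp hq (lam i))), h1]
    with x h2 h3 h4 h5
  rw [h2, Pi.sub_apply, h3, h4, Finset.sum_apply, Finset.sum_congr rfl h5]

/-- The Parseval equality of `(f, 0)` in `H`; the zero third component contributes nothing to the
norm. -/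
lemma hasSum_alpha_mul_coeff (hp : MemLp p 2 mu) (hq : MemLp q 2 mu) (hh₂ : 0 < h₂)
    (hinj : Function.Injective lam)
    (hlam : range lam = {z | IsEigenvalue p q h₁ h₂ z}) {f : ℝ → C2} (hf : MemLp f 2 mu) :
    HasSum (fun i => alpha p q h₂ (lam i) * ‖coeff p q h₂ f (lam i)‖ ^ 2)
      (∫ x, ‖f x‖ ^ 2 ∂mu) := by
  have h := hasSum_parseval hp hq hh₂ hinj hlam (inclL2 f hf)
  simp only [← coeff_eq hp hq hh₂] at h
  convert h using 1
  have h1 : inner ℂ (hf.toLp f) (hf.toLp f) = ((∫ x, ‖f x‖ ^ 2 ∂mu : ℝ) : ℂ) := by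
    rw [L2.inner_def, ← integral_complex_ofReal]
    refine integral_congr_ae ?_
    filter_upwards [hf.coeFn_toLp] with x hx
    rw [hx, inner_self_eq_norm_sq_to_K]
    push_cast
    rfl
  rw [inner_self_eq_norm_sq_to_K] at h1
  have h2 : ‖inclL2 f hf‖ ^ 2 = ‖hf.toLp f‖ ^ 2 := by
    rw [WithLp.prod_norm_sq_eq_of_L2]
    simp [inclL2]
  rw [h2]
  exact Complex.ofReal_injective (h1.symm.trans (Complex.ofReal_pow _ _).symm)

lemma isCompleteSystem_phi (hp : MemLp p 2 mu) (hq : MemLp q 2 mu) (hh₂ : 0 < h₂)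
    (hinj : Function.Injective lam) (hlam : range lam = {z | IsEigenvalue p q h₁ h₂ z}) :
    IsCompleteSystem fun i => phi p q (lam i) := by
  have hu : ∀ i, MemLp (phi p q (lam i)) 2 mu := fun i =>
    (Lp.memLp (toL2 (phiC hp hq (lam i)))).ae_eq (phi_ae hp hq (lam i)).symm
  refine ⟨hu, eq_top_iff.2 fun F _ => ?_⟩
  have h := hasSum_coeff hp hq hh₂ hinj hlam (Lp.memLp F)
  rw [Lp.toLp_coeFn] at h
  refine mem_closure_of_tendsto h (Eventually.of_forall fun s => ?_)
  refine Submodule.sum_mem _ fun i _ => Submodule.smul_mem _ _ (Submodule.subset_span ⟨i, ?_⟩)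
  exact Lp.ext ((hu i).coeFn_toLp.trans (phi_ae hp hq (lam i)))

/-! ### Uniform convergence on the domain of `L` -/

/-- The eigenfunction expansion of an element of the domain of `L`, in `C([0, π])`. -/
lemma hasSum_coeffH (hh₂ : 0 < h₂) (hinj : Function.Injective lam)
    (hlam : range lam = {z | IsEigenvalue p q h₁ h₂ z}) {Y : (ℝ → C2) × ℂ} (hY : Y ∈ domL p q) :
    HasSum (fun i => coeffH p q h₂ Y (lam i) • phiC hp hq (lam i))
      (restrictIcc Y.1 hY.1.continuousOn) := by
  obtain ⟨hAC, hY2, hL, hY0⟩ := hY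
  obtain ⟨μ, hμ⟩ := exists_real_not_isEigenvalue (h₁ := h₁) hp hq hh₂
  set y := restrictIcc Y.1 hAC.continuousOn with hy
  have hs := ofReal_sqrt_ne_zero hh₂
  have hext : ∀ x ∈ Icc 0 π, extend y x = Y.1 x := fun x hx => extend_restrictIcc _ hx
  -- `W` is `LY` in the rescaled coordinates, and `X` below is `(L - μ)Y`.
  set W : HSpace := WithLp.toLp 2 (hL.toLp _, (√h₂ : ℂ)⁻¹ * boundary h₁ h₂ y) with hW
  have hg : IsInGraph hp hq h₁ h₂ y W :=
    ⟨by rw [hext 0 zero_mem_Icc, hY0], isPotential_restrictIcc hp hq hAC hL.coeFn_toLp.symm,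
      mul_inv_cancel_left₀ hs _⟩
  set X := W - (μ : ℂ) • embed h₂ y with hX
  have hyX : y = resolventC hp hq h₁ h₂ μ X := by
    rw [eq_resolventC_iff hp hq hh₂ hμ, hX, sub_add_cancel]
    exact hg
  -- Continuity of the resolvent into `C([0, π])` turns convergence in `H` into uniform convergence.
  have h := (hasSum_fourierCoeff hp hq hh₂ hinj hlam X).mapL (resolventC hp hq h₁ h₂ μ)
  rw [← hyX] at h
  refine hasSum_of_eq (fun i => ?_) h
  have hi : IsEigenvalue p q h₁ h₂ (lam i) := hlam.subset (mem_range_self i)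
  have hne : lam i - μ ≠ 0 := sub_ne_zero.2 fun h => hμ (h ▸ hi)
  have hphi : phiC hp hq (lam i) =
      (lam i - μ) • resolventC hp hq h₁ h₂ μ (embed h₂ (phiC hp hq (lam i))) := by
    rw [← map_smul, eq_resolventC_iff hp hq hh₂ hμ, ← add_smul, sub_add_cancel]
    exact hi.isInGraph hp hq hh₂
  have hin := hg.inner_eq hp hq hh₂ (hi.isInGraph hp hq hh₂)
  rw [inner_smul_left, hi.conj_eq hp hq hh₂] at hin
  -- By symmetry, `L - μ` multiplies the coefficients by `lam i - μ`; the resolvent divides the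
  -- eigenvectors by the same factor, so the two cancel.
  have hcoef : fourierCoeff hp hq h₂ X (lam i) = (lam i - μ) * coeffH p q h₂ Y (lam i) := by
    rw [coeffH_eq hp hq hh₂ (lam i) (X := embed h₂ y) (toL2_restrictIcc_ae _).symm
      (by rw [embed_snd, endpoint_apply, hext π pi_mem_Icc, hY2]), fourierCoeff, fourierCoeff, hX,
      inner_sub_right, inner_smul_right, hin]
    ring
  rw [map_smul, hcoef, mul_comm, mul_smul, ← hphi]

lemma hasSumUniformlyOn_expansion (hp : MemLp p 2 mu) (hq : MemLp q 2 mu) (hh₂ : 0 < h₂)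
    (hinj : Function.Injective lam)
    (hlam : range lam = {z | IsEigenvalue p q h₁ h₂ z}) {Y : (ℝ → C2) × ℂ}
    (hY : Y ∈ domL p q) :
    HasSumUniformlyOn (fun (i : ι) (x : ℝ) => coeffH p q h₂ Y (lam i) • phi p q (lam i) x)
      Y.1 (Icc 0 π) := by
  have h := hasSum_coeffH hp hq hh₂ hinj hlam hY
  rw [hasSumUniformlyOn_iff_tendstoUniformlyOn, Metric.tendstoUniformlyOn_iff]
  intro ε hε
  filter_upwards [(Metric.tendsto_nhds.1 h) ε hε] with s hs x hx
  refine lt_of_le_of_lt ?_ hs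
  rw [dist_comm]
  have h1 := BoundedContinuousFunction.dist_coe_le_dist (f := ∑ i ∈ s,
    coeffH p q h₂ Y (lam i) • phiC hp hq (lam i)) (g := restrictIcc Y.1 hY.1.continuousOn) ⟨x, hx⟩
  rw [← extend_coe (restrictIcc Y.1 hY.1.continuousOn), extend_restrictIcc _ hx,
    BoundedContinuousFunction.sum_apply] at h1
  refine (le_of_eq ?_).trans h1
  congr 1
  refine Finset.sum_congr rfl fun i _ => ?_
  rw [phi_eq_phiC hp hq (lam i) hx]
  exact congrArg (fun v => coeffH p q h₂ Y (lam i) • v) (extend_coe _ ⟨x, hx⟩)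

end Expansion

end DiracBVP

end

theorem mainTheorem4 (p q : ℝ → ℝ) (hp : MemLp p 2 DiracBVP.mu) (hq : MemLp q 2 DiracBVP.mu)
    (h₁ h₂ : ℝ) (hh₂ : 0 < h₂) :
    -- the solutions `φ(·, z)` exist, and the eigenvalues can be listed as `(lam n)`, `n ∈ ℤ`
    (∀ z : ℂ, DiracBVP.IsPhi p q z (DiracBVP.phi p q z)) ∧
    (∃ lam : ℤ → ℂ, DiracBVP.IsEigenvalueEnum p q h₁ h₂ lam) ∧
    ∀ lam : ℤ → ℂ, DiracBVP.IsEigenvalueEnum p q h₁ h₂ lam →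
      -- completeness
      DiracBVP.IsCompleteSystem (fun n : ℤ => DiracBVP.phi p q (lam n)) ∧
      -- uniform convergence of the expansion on `D(L)`
      (∀ Y ∈ DiracBVP.domL p q,
        HasSumUniformlyOn
          (fun (n : ℤ) (x : ℝ) =>
            DiracBVP.coeffH p q h₂ Y (lam n) • DiracBVP.phi p q (lam n) x)
          Y.1 (Icc 0 π)) ∧
      -- convergence in `L₂` and the Parseval equality
      (∀ f : ℝ → DiracBVP.C2, MemLp f 2 DiracBVP.mu →
        Tendsto
          (fun s : Finset ℤ => eLpNorm
            (fun x => f x - ∑ n ∈ s,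
              DiracBVP.coeff p q h₂ f (lam n) • DiracBVP.phi p q (lam n) x) 2 DiracBVP.mu)
          atTop (𝓝 0) ∧
        HasSum
          (fun n : ℤ =>
            DiracBVP.alpha p q h₂ (lam n) * ‖DiracBVP.coeff p q h₂ f (lam n)‖ ^ 2)
          (∫ x, ‖f x‖ ^ 2 ∂DiracBVP.mu)) := by
  refine ⟨DiracBVP.isPhi_phi hp hq, DiracBVP.exists_isEigenvalueEnum hp hq hh₂, ?_⟩
  rintro lam ⟨hinj, hlam⟩
  exact ⟨DiracBVP.isCompleteSystem_phi hp hq hh₂ hinj hlam,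
    fun Y hY => DiracBVP.hasSumUniformlyOn_expansion hp hq hh₂ hinj hlam hY,
    fun f hf => ⟨DiracBVP.tendsto_eLpNorm_expansion hp hq hh₂ hinj hlam hf,
      DiracBVP.hasSum_alpha_mul_coeff hp hq hh₂ hinj hlam hf⟩⟩
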